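/- Fix an abelian group $\Lambda$. A graded superring is a $\Lambda\times\mathbb Z_2$-graded (associative unital) ring; modules are $\Lambda\times\mathbb Z_2$-graded modules, $A\text{-mod}$ is the category of left $A$-modules with $A$-linear maps of degree $(0,0)$ as morphisms, ring homomorphisms and automorphisms have degree $0$, and $\bar v$ denotes the $\mathbb Z_2$-degree of a homogeneous element $v$ (formulas involving $\bar v$ are for homogeneous elements and are extended additively). The module $\{\lambda,\pi\}M$ is $M$ with the grading $(\{\lambda,\pi\}M)_{\lambda',\pi'}=M_{\lambda'-\lambda,\pi'-\pi}$ and the action $a\cdot m=(-1)^{\pi\bar a}am$. $\mathrm{HOM}_B(M,N)$ is the direct sum over $(\lambda,\pi)$ of the groups of additive maps $f\colon M\to N$ that are homogeneous of degree $(\lambda,\pi)$ and satisfy $f(bm)=(-1)^{\pi\bar b}bf(m)$. For a graded subring $B\subseteq A$ and automorphisms $\alpha$ of $A$ and $\beta$ of $B$, $A$ is an $(\alpha,\beta)$-Frobenius extension of $B$ of degree $(-\lambda,\pi)$ if $A$ is finitely generated and projective as a left $B$-module and there is a trace map, i.e. an additive map $\mathrm{tr}\colon A\to B$, homogeneous of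 degree $(-\lambda,\pi)$, with $\mathrm{tr}(\beta(b)a)=(-1)^{\pi\bar b}b\,\mathrm{tr}(a)$ and $\mathrm{tr}(a\alpha(b))=\mathrm{tr}(a)b$ for $a\in A$, $b\in B$, such that (T1) $\mathrm{tr}(Aa)=0$ implies $a=0$, and (T2) every $\varphi\in\mathrm{HOM}_B({}^\beta_BA,\{\lambda,\pi\}B)$ has the form $\varphi(c)=\mathrm{tr}\big((-1)^{\bar a\bar c}ca\big)$ for some $a\in A$; here ${}^\beta_BA$ is $A$ with the left action $b\cdot a=\beta(b)a$. It is untwisted if $\alpha$ and $\beta$ are identities. **Theorem.** Let $R\subseteq B\subseteq A$ be graded superrings with $C_A(R)=A$, i.e. $ar=(-1)^{\bar a\bar r}ra$ for all $a\in A$, $r\in R$. Suppose that $A$ and $B$ are untwisted Frobenius extensions of $R$ of degrees $(-\lambda_A,\pi_A)$ and $(-\lambda_B,\pi_B)$, with trace maps $\mathrm{tr}_A$ and $\mathrm{tr}_B$, and that $A$ is projective as a left $B$-module. Then: 1. There are unique automorphisms $\psi_A$ of $A$ and $\psi_B$ of $B$ (the Nakayama automorphisms) with $\mathrm{tr}_A(ca)=(-1)^{\bar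 a\bar c}\,\mathrm{tr}_A(a\psi_A(c))$ for all $a,c\in A$ and $\mathrm{tr}_B(ca)=(-1)^{\bar a\bar c}\,\mathrm{tr}_B(a\psi_B(c))$ for all $a,c\in B$. There are also dual sets of generators of $B$ over $R$: homogeneous elements $x_1,\dots,x_n$, $y_1,\dots,y_n$ of $B$ with $\deg x_i+\deg y_i=(\lambda_B,\pi_B)$ and, for all $b\in B$, $$b=(-1)^{\pi_B\bar b}\sum_{i=1}^n(-1)^{\pi_B\bar x_i}\,\mathrm{tr}_B(by_i)x_i=\sum_{i=1}^n y_i\,\mathrm{tr}_B(x_ib).$$ 2. $A$ is a $(\psi_A,\psi_B)$-Frobenius extension of $B$ of degree $(\lambda_B-\lambda_A,\pi_A+\pi_B)$. For any dual sets of generators $\{x_i\}$, $\{y_i\}$ of $B$ over $R$, a trace map for it is given by $$\mathrm{tr}(a)=(-1)^{\pi_B(\pi_A+\bar a)}\sum_{i=1}^n(-1)^{\bar y_i(\pi_B+\bar a)}\,\mathrm{tr}_A(y_ia)\,x_i .$$ 3. The induction functor ${}_AA_B\otimes_B-\colon B\text{-mod}\to A\text{-mod}$ is right adjoint to the shifted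 twisted restriction functor $\{\lambda_B-\lambda_A,\pi_A+\pi_B\}\,{}^{\psi_B}_BA^{\psi_A}_A\otimes_A-\colon A\text{-mod}\to B\text{-mod}$, where ${}^{\psi_B}_BA^{\psi_A}_A$ is $A$ with the left action $b\cdot a=\psi_B(b)a$ of $B$ and the right action $a\cdot a'=a\psi_A(a')$ of $A$. -/

import Mathlib

open DirectSum TensorProduct CategoryTheory

universe t u u₁ u₂ v w

noncomputable section

namespace NestedFrobenius

variable {Λ : Type t} [AddCommGroup Λ] [DecidableEq Λ]

/-! ### Signs

A graded superring is a ring `A` with `GradedRing 𝒜`, where `𝒜 : Λ × ZMod 2 → AddSubgroup A`. -/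

section Signs

variable {M : Type*} [AddCommGroup M] (ℳ : Λ × ZMod 2 → AddSubgroup M) [Decomposition ℳ]

/-- The additive map with `m ↦ (-1) ^ (p * m̄) m` for homogeneous `m`. -/
def signTwist (p : ZMod 2) : M →+ M :=
  (DirectSum.toAddMonoid fun i : Λ × ZMod 2 =>
    ((-1 : ℤˣ) ^ (p * i.2)) • (ℳ i).subtype).comp (decomposeAddEquiv ℳ).toAddMonoidHom

theorem signTwist_of_mem (p : ZMod 2) {i : Λ × ZMod 2} {m : M} (hm : m ∈ ℳ i) :
    signTwist ℳ p m = ((-1 : ℤˣ) ^ (p * i.2)) • m := by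
  simp [signTwist, decompose_of_mem ℳ hm]

theorem of_congr {ι M : Type*} [DecidableEq ι] [AddCommGroup M] (ℳ : ι → AddSubgroup M)
    {i k : ι} (h : i = k) (x : ℳ i) (y : ℳ k) (hxy : (x : M) = y) :
    DirectSum.of (fun i => ℳ i) i x = DirectSum.of (fun i => ℳ i) k y := by
  subst h
  rw [Subtype.ext hxy]

end Signs

section Rings

variable {A : Type*} [Ring A] (𝒜 : Λ × ZMod 2 → AddSubgroup A) [GradedRing 𝒜]

/-- `signTwist` on a graded superring is a ring homomorphism. -/
def signHom (p : ZMod 2) : A →+* A :=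
  { signTwist 𝒜 p with
    map_one' := by
      have h : (1 : A) ∈ 𝒜 0 := SetLike.GradedOne.one_mem
      change signTwist 𝒜 p 1 = 1
      rw [signTwist_of_mem 𝒜 p h]
      simp
    map_mul' := by
      intro x y
      change signTwist 𝒜 p (x * y) = signTwist 𝒜 p x * signTwist 𝒜 p y
      induction x using Decomposition.inductionOn 𝒜 with
      | zero => simp
      | add a b ha hb => rw [add_mul, map_add, ha, hb, map_add, add_mul]
      | @homogeneous i a =>
        induction y using Decomposition.inductionOn 𝒜 with
        | zero => simp
        | add b c hb hc => rw [mul_add, map_add, hb, hc, map_add, mul_add]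
        | @homogeneous k b =>
          rw [signTwist_of_mem 𝒜 p a.2, signTwist_of_mem 𝒜 p b.2,
            signTwist_of_mem 𝒜 p (SetLike.mul_mem_graded a.2 b.2), Prod.snd_add, mul_add,
            uzpow_add, smul_mul_smul_comm] }

theorem signHom_of_mem (p : ZMod 2) {i : Λ × ZMod 2} {a : A} (ha : a ∈ 𝒜 i) :
    signHom 𝒜 p a = ((-1 : ℤˣ) ^ (p * i.2)) • a :=
  signTwist_of_mem 𝒜 p ha

/-- The signed right multiplication operator: for homogeneous `a` and `m`, it is
`ʳa (m) = (-1) ^ (ā * m̄) m a`; it is additive in `a` and in `m`. -/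
def rightOp : A →+ A →+ A :=
  (DirectSum.toAddMonoid fun i : Λ × ZMod 2 =>
    ((AddMonoidHom.compHom.flip (signTwist 𝒜 i.2)).comp
      (AddMonoidHom.mul (R := A)).flip).comp (𝒜 i).subtype).comp
    (decomposeAddEquiv 𝒜).toAddMonoidHom

theorem rightOp_of_mem {i k : Λ × ZMod 2} {a m : A} (ha : a ∈ 𝒜 i) (hm : m ∈ 𝒜 k) :
    rightOp 𝒜 a m = ((-1 : ℤˣ) ^ (i.2 * k.2)) • (m * a) := by
  simp [rightOp, decompose_of_mem 𝒜 ha, signTwist_of_mem 𝒜 _ hm, smul_mul_assoc]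

variable {𝒜} {R : Type*} [Ring R] {ℛ : Λ × ZMod 2 → AddSubgroup R} [GradedRing ℛ]

/-- The centralizer `C_A(R)`, for `f : R → A`: all `a` whose homogeneous components `c` satisfy
`c r = (-1) ^ (c̄ * r̄) r c` for every homogeneous `r` in `R`. -/
def superCentralizer (f : ℛ →+*ᵍ 𝒜) : AddSubgroup A where
  carrier := {a | ∀ (i k : Λ × ZMod 2) (r : R), r ∈ ℛ k →
    (decompose 𝒜 a i : A) * f r = ((-1 : ℤˣ) ^ (i.2 * k.2)) • (f r * (decompose 𝒜 a i : A))}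
  zero_mem' := by intro i k r _; simp
  add_mem' := by
    intro a b ha hb i k r hr
    simp only [decompose_add, DirectSum.add_apply, AddMemClass.coe_add, add_mul, mul_add,
      smul_add, ha i k r hr, hb i k r hr]
  neg_mem' := by
    intro a ha i k r hr
    have h : (decompose 𝒜 (-a) i : A) = -(decompose 𝒜 a i : A) := by rw [decompose_neg]; rfl
    rw [h, neg_mul, mul_neg, smul_neg, ha i k r hr]

end Rings

/-! ### Graded supermodules -/

/-- Left graded supermodules over the graded superring `B`. -/
structure GSMod {B : Type u} [Ring B] (ℬ : Λ × ZMod 2 → AddSubgroup B) where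
  carrier : Type w
  [addCommGroup : AddCommGroup carrier]
  [module : Module B carrier]
  grading : Λ × ZMod 2 → AddSubgroup carrier
  [decomposition : Decomposition grading]
  smul_mem : ∀ {i k : Λ × ZMod 2} {b : B} {m : carrier},
    b ∈ ℬ i → m ∈ grading k → b • m ∈ grading (i + k)

attribute [instance] GSMod.addCommGroup GSMod.module GSMod.decomposition

namespace GSMod

variable {B : Type u} [Ring B] {ℬ : Λ × ZMod 2 → AddSubgroup B}

/-- `HOM_B(M, N)_d`, the homomorphisms of degree `d`. -/
def homDeg (M N : GSMod ℬ) (d : Λ × ZMod 2) : AddSubgroup (M.carrier →+ N.carrier) where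
  carrier := {f | (∀ (i : Λ × ZMod 2) (m : M.carrier), m ∈ M.grading i → f m ∈ N.grading (d + i)) ∧
    ∀ (i : Λ × ZMod 2) (b : B) (m : M.carrier), b ∈ ℬ i →
      f (b • m) = ((-1 : ℤˣ) ^ (d.2 * i.2)) • b • f m}
  zero_mem' := ⟨fun _ _ _ => zero_mem _, fun _ _ _ _ => by simp⟩
  add_mem' := by
    rintro f g ⟨hf, hf'⟩ ⟨hg, hg'⟩
    refine ⟨fun i m hm => add_mem (hf i m hm) (hg i m hm), fun i b m hb => ?_⟩
    simp [hf' i b m hb, hg' i b m hb]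
  neg_mem' := by
    rintro f ⟨hf, hf'⟩
    refine ⟨fun i m hm => neg_mem (hf i m hm), fun i b m hb => ?_⟩
    simp [hf' i b m hb]

/-- `HOM_B(M, N)`, the (automatically direct) sum of the groups `HOM_B(M, N)_d`. -/
def HOM (M N : GSMod ℬ) : AddSubgroup (M.carrier →+ N.carrier) := ⨆ d, homDeg M N d

/-- Morphisms of graded supermodules: linear maps of degree zero. -/
@[ext]
structure Hom (M N : GSMod ℬ) where
  toLinearMap : M.carrier →ₗ[B] N.carrier
  map_mem : ∀ (i : Λ × ZMod 2) (m : M.carrier), m ∈ M.grading i → toLinearMap m ∈ N.grading i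

instance : Category (GSMod.{t, u, w} ℬ) where
  Hom M N := Hom M N
  id M := ⟨LinearMap.id, fun _ _ h => h⟩
  comp f g := ⟨g.toLinearMap.comp f.toLinearMap, fun i m h => g.map_mem i _ (f.map_mem i m h)⟩

/-- The graded supermodule `A`, on which `B` acts through `f : B → A` and left multiplication.
For an automorphism `β` of `B` and `j : B → A`, the choice `f = j ∘ β` gives `^β_B A`. -/
def ofHom {A : Type w} [Ring A] {𝒜 : Λ × ZMod 2 → AddSubgroup A} [GradedRing 𝒜]
    (f : ℬ →+*ᵍ 𝒜) : GSMod ℬ where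
  carrier := A
  module := Module.compHom A f.toRingHom
  grading := 𝒜
  smul_mem hb hm := SetLike.mul_mem_graded (f.map_mem hb) hm

section Shift

/-- The decomposition of `M` for the shifted grading `k ↦ M_{k - d}`. -/
abbrev shiftDecomposition {M : Type*} [AddCommGroup M] (ℳ : Λ × ZMod 2 → AddSubgroup M)
    [Decomposition ℳ] (d : Λ × ZMod 2) : Decomposition fun k => ℳ (k - d) :=
  Decomposition.ofAddHom _
    ((DirectSum.toAddMonoid fun i : Λ × ZMod 2 =>
      (DirectSum.of (fun k => ℳ (k - d)) (i + d)).comp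
        (AddSubgroup.inclusion (le_of_eq (congrArg ℳ (add_sub_cancel_right i d).symm)))).comp
      (decomposeAddEquiv ℳ).toAddMonoidHom)
    (by
      ext m
      induction m using Decomposition.inductionOn ℳ with
      | zero => simp
      | add a b ha hb => rw [map_add, ha, hb, map_add]
      | homogeneous a => simp)
    (by
      ext k ⟨m, hm⟩ : 2
      have : decompose ℳ m = DirectSum.of (fun i => ℳ i) (k - d) ⟨m, hm⟩ := decompose_of_mem ℳ hm
      simp only [AddMonoidHom.comp_apply, coeAddMonoidHom_of, AddEquiv.toAddMonoidHom_eq_coe,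
        AddMonoidHom.coe_coe, decomposeAddEquiv_apply, this, toAddMonoid_of, AddMonoidHom.id_apply]
      exact of_congr (fun k => ℳ (k - d)) (sub_add_cancel k d) _ _ rfl)

variable [GradedRing ℬ]

/-- The shift `{lam, p} M`: the group `M` with grading `({lam, p} M)_k = M_{k - (lam, p)}` and with
the action of a homogeneous `b` given by `(-1) ^ (p * b̄) b m`. -/
def shift (lam : Λ) (p : ZMod 2) (M : GSMod.{t, u, w} ℬ) : GSMod.{t, u, w} ℬ where
  carrier := M.carrier
  module := Module.compHom M.carrier (signHom ℬ p)
  grading := fun k => M.grading (k - (lam, p))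
  decomposition := shiftDecomposition M.grading (lam, p)
  smul_mem := by
    intro i k b m hb hm
    change signHom ℬ p b • m ∈ M.grading (i + k - (lam, p))
    rw [add_sub_assoc]
    refine M.smul_mem ?_ hm
    rw [signHom_of_mem ℬ p hb, Units.smul_def]
    exact zsmul_mem hb _

/-- The shift functor `{lam, p}`, which leaves morphisms unchanged. -/
def shiftFunctor (lam : Λ) (p : ZMod 2) : GSMod.{t, u, w} ℬ ⥤ GSMod.{t, u, w} ℬ where
  obj M := shift lam p M
  map f :=
    { toLinearMap :=
        { toFun := f.toLinearMap
          map_add' := f.toLinearMap.map_add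
          map_smul' := fun b m => f.toLinearMap.map_smul (signHom ℬ p b) m }
      map_mem := fun k m hm => f.map_mem (k - (lam, p)) m hm }

end Shift

end GSMod

/-! ### Graded superbimodules and tensor products -/

/-- Graded `(A₁, A₂)`-superbimodules; the right action of `A₂` is an action of `A₂ᵐᵒᵖ`. -/
structure GSBimod {A₁ : Type u₁} [Ring A₁] (𝒜₁ : Λ × ZMod 2 → AddSubgroup A₁)
    {A₂ : Type u₂} [Ring A₂] (𝒜₂ : Λ × ZMod 2 → AddSubgroup A₂) where
  carrier : Type v
  [addCommGroup : AddCommGroup carrier]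
  [leftModule : Module A₁ carrier]
  [rightModule : Module A₂ᵐᵒᵖ carrier]
  [smulCommClass : SMulCommClass A₁ A₂ᵐᵒᵖ carrier]
  grading : Λ × ZMod 2 → AddSubgroup carrier
  [decomposition : Decomposition grading]
  smul_mem : ∀ {i k : Λ × ZMod 2} {a : A₁} {x : carrier},
    a ∈ 𝒜₁ i → x ∈ grading k → a • x ∈ grading (i + k)
  op_smul_mem : ∀ {i k : Λ × ZMod 2} {a : A₂} {x : carrier},
    x ∈ grading i → a ∈ 𝒜₂ k → MulOpposite.op a • x ∈ grading (i + k)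

attribute [instance] GSBimod.addCommGroup GSBimod.leftModule GSBimod.rightModule
  GSBimod.smulCommClass GSBimod.decomposition

namespace GSBimod

variable {A₁ : Type u₁} [Ring A₁] {𝒜₁ : Λ × ZMod 2 → AddSubgroup A₁}
  {A₂ : Type u₂} [Ring A₂] {𝒜₂ : Λ × ZMod 2 → AddSubgroup A₂}

/-- The bimodule with underlying group the ring `C`, on which `A₁` acts by `a · c = f(a) c` and
`A₂` acts by `c · a = c g(a)`. -/
def ofHoms {C : Type v} [Ring C] {𝒞 : Λ × ZMod 2 → AddSubgroup C} [GradedRing 𝒞]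
    (f : 𝒜₁ →+*ᵍ 𝒞) (g : 𝒜₂ →+*ᵍ 𝒞) : GSBimod.{t, u₁, u₂, v} 𝒜₁ 𝒜₂ where
  carrier := C
  leftModule := Module.compHom C f.toRingHom
  rightModule := Module.compHom C (RingHom.op g.toRingHom)
  smulCommClass :=
    letI := Module.compHom C f.toRingHom
    letI := Module.compHom C (RingHom.op g.toRingHom)
    ⟨fun a b c => (mul_assoc (f a) c (g b.unop)).symm⟩
  grading := 𝒞
  smul_mem ha hx := SetLike.mul_mem_graded (f.map_mem ha) hx
  op_smul_mem hx ha := SetLike.mul_mem_graded hx (g.map_mem ha)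

variable (P : GSBimod.{t, u₁, u₂, v} 𝒜₁ 𝒜₂)

/-- The relations `x a ⊗ m = x ⊗ a m` that define `P ⊗_{A₂} M` as a quotient of `P ⊗_ℤ M`. The
set of relators is stable under the left action of `A₁`, so that their `A₁`-span is the subgroup
generated by them. -/
def tensorRel (M : GSMod.{t, u₂, w} 𝒜₂) : Submodule A₁ (P.carrier ⊗[ℤ] M.carrier) :=
  Submodule.span A₁ {z | ∃ (x : P.carrier) (a : A₂) (m : M.carrier),
    z = (MulOpposite.op a • x) ⊗ₜ[ℤ] m - x ⊗ₜ[ℤ] (a • m)}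

/-- The underlying group of `P ⊗_{A₂} M`, with its left action of `A₁`. -/
abbrev TensorCarrier (M : GSMod.{t, u₂, w} 𝒜₂) : Type (max v w) :=
  (P.carrier ⊗[ℤ] M.carrier) ⧸ P.tensorRel M

/-- The element `x ⊗ m` of `P ⊗_{A₂} M`. -/
def tmul (M : GSMod.{t, u₂, w} 𝒜₂) (x : P.carrier) (m : M.carrier) : P.TensorCarrier M :=
  (P.tensorRel M).mkQ (x ⊗ₜ[ℤ] m)

/-- The degree `d` part of `P ⊗_{A₂} M`: it is generated by the `x ⊗ m` with `x` and `m`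
homogeneous of degrees that add up to `d`. -/
def tensorGrading (M : GSMod.{t, u₂, w} 𝒜₂) (d : Λ × ZMod 2) : AddSubgroup (P.TensorCarrier M) :=
  AddSubgroup.closure {z | ∃ (i k : Λ × ZMod 2) (x : P.carrier) (m : M.carrier),
    i + k = d ∧ x ∈ P.grading i ∧ m ∈ M.grading k ∧ z = P.tmul M x m}

variable {P} in
theorem tmul_mem {M : GSMod.{t, u₂, w} 𝒜₂} {i k : Λ × ZMod 2} {x : P.carrier} {m : M.carrier}
    (hx : x ∈ P.grading i) (hm : m ∈ M.grading k) : P.tmul M x m ∈ P.tensorGrading M (i + k) :=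
  AddSubgroup.subset_closure ⟨i, k, x, m, rfl, hx, hm, rfl⟩

theorem tmul_add (M : GSMod.{t, u₂, w} 𝒜₂) (x : P.carrier) (m n : M.carrier) :
    P.tmul M x (m + n) = P.tmul M x m + P.tmul M x n := by
  simp only [tmul, TensorProduct.tmul_add, map_add]

theorem add_tmul (M : GSMod.{t, u₂, w} 𝒜₂) (x y : P.carrier) (m : M.carrier) :
    P.tmul M (x + y) m = P.tmul M x m + P.tmul M y m := by
  simp only [tmul, TensorProduct.add_tmul, map_add]

theorem op_smul_tmul (M : GSMod.{t, u₂, w} 𝒜₂) (x : P.carrier) (a : A₂) (m : M.carrier) :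
    P.tmul M (MulOpposite.op a • x) m = P.tmul M x (a • m) :=
  (Submodule.Quotient.eq _).2 (Submodule.subset_span ⟨x, a, m, rfl⟩)

theorem smul_tmul (M : GSMod.{t, u₂, w} 𝒜₂) (a : A₁) (x : P.carrier) (m : M.carrier) :
    a • P.tmul M x m = P.tmul M (a • x) m := rfl

/-- The additive map out of `P ⊗_{A₂} M` given by a balanced biadditive map. -/
def tensorLift (M : GSMod.{t, u₂, w} 𝒜₂) {G : Type*} [AddCommGroup G]
    (φ : P.carrier →+ M.carrier →+ G)
    (h : ∀ x (a : A₂) m, φ (MulOpposite.op a • x) m = φ x (a • m)) : P.TensorCarrier M →+ G :=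
  let L : P.carrier ⊗[ℤ] M.carrier →+ G :=
    TensorProduct.liftAddHom φ fun n x m => by simp
  QuotientAddGroup.lift (P.tensorRel M).toAddSubgroup L (by
    intro z hz
    refine Submodule.closure_induction (p := fun z _ => L z = 0) (map_zero L)
      (fun x y _ _ hx hy => by rw [map_add, hx, hy, add_zero]) ?_ hz
    rintro b _ ⟨x, a, m, rfl⟩
    rw [smul_sub, map_sub, sub_eq_zero, TensorProduct.smul_tmul', TensorProduct.smul_tmul',
      smul_comm b]
    exact h (b • x) a m)

theorem tensorLift_tmul (M : GSMod.{t, u₂, w} 𝒜₂) {G : Type*} [AddCommGroup G]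
    (φ : P.carrier →+ M.carrier →+ G)
    (h : ∀ x (a : A₂) m, φ (MulOpposite.op a • x) m = φ x (a • m)) (x : P.carrier)
    (m : M.carrier) : P.tensorLift M φ h (P.tmul M x m) = φ x m := rfl

theorem tensor_induction {M : GSMod.{t, u₂, w} 𝒜₂} {p : P.TensorCarrier M → Prop}
    (h0 : p 0) (hadd : ∀ y z, p y → p z → p (y + z)) (ht : ∀ x m, p (P.tmul M x m)) (z) : p z := by
  obtain ⟨z, rfl⟩ := (P.tensorRel M).mkQ_surjective z
  induction z using TensorProduct.induction_on with
  | zero => rwa [map_zero]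
  | tmul x m => exact ht x m
  | add y z hy hz => rw [map_add]; exact hadd _ _ hy hz

/-- The biadditive map `(x, m) ↦ x ⊗ m` on homogeneous parts. -/
def gradedTmul (M : GSMod.{t, u₂, w} 𝒜₂) (i k : Λ × ZMod 2) :
    P.grading i →+ M.grading k →+ P.tensorGrading M (i + k) :=
  AddMonoidHom.mk' (fun x => AddMonoidHom.mk' (fun m => ⟨P.tmul M x m, tmul_mem x.2 m.2⟩)
    (fun m n => Subtype.ext (P.tmul_add M x m n)))
    (fun x y => AddMonoidHom.ext fun m => Subtype.ext (P.add_tmul M x y m))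

/-- The biadditive map `(x, m) ↦ ∑ i k, x_i ⊗ m_k`, with `x_i ⊗ m_k` placed in degree `i + k`. -/
def tensorSplit (M : GSMod.{t, u₂, w} 𝒜₂) :
    P.carrier →+ M.carrier →+ ⨁ d, P.tensorGrading M d :=
  (AddMonoidHom.compHom.flip (decomposeAddEquiv M.grading).toAddMonoidHom).comp
    ((DirectSum.toAddMonoid fun i => AddMonoidHom.flip (DirectSum.toAddMonoid fun k =>
      AddMonoidHom.flip ((AddMonoidHom.compHom
        (DirectSum.of (fun d => P.tensorGrading M d) (i + k))).comp (P.gradedTmul M i k)))).comp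
    (decomposeAddEquiv P.grading).toAddMonoidHom)

theorem tensorSplit_of_mem (M : GSMod.{t, u₂, w} 𝒜₂) {i k : Λ × ZMod 2} {x : P.carrier}
    {m : M.carrier} (hx : x ∈ P.grading i) (hm : m ∈ M.grading k) :
    P.tensorSplit M x m =
      DirectSum.of (fun d => P.tensorGrading M d) (i + k) ⟨P.tmul M x m, tmul_mem hx hm⟩ := by
  simp [tensorSplit, gradedTmul, decompose_of_mem P.grading hx, decompose_of_mem M.grading hm]

variable [GradedRing 𝒜₂]

theorem tensorSplit_balanced (M : GSMod.{t, u₂, w} 𝒜₂) (x : P.carrier) (a : A₂) (m : M.carrier) :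
    P.tensorSplit M (MulOpposite.op a • x) m = P.tensorSplit M x (a • m) := by
  induction a using Decomposition.inductionOn 𝒜₂ with
  | zero => simp
  | add a b ha hb => rw [MulOpposite.op_add, add_smul, add_smul, map_add, map_add,
      AddMonoidHom.add_apply, ha, hb]
  | homogeneous a =>
    induction x using Decomposition.inductionOn P.grading with
    | zero => simp
    | add x y hx hy => rw [smul_add, map_add, map_add, AddMonoidHom.add_apply,
        AddMonoidHom.add_apply, hx, hy]
    | homogeneous x =>
      induction m using Decomposition.inductionOn M.grading with
      | zero => simp
      | add m n hm hn => rw [smul_add, map_add, map_add, hm, hn]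
      | homogeneous m =>
        rw [P.tensorSplit_of_mem M (P.op_smul_mem x.2 a.2) m.2,
          P.tensorSplit_of_mem M x.2 (M.smul_mem a.2 m.2)]
        exact of_congr _ (add_assoc _ _ _) _ _ (P.op_smul_tmul M x a m)

/-- `P ⊗_{A₂} M` is the direct sum of its homogeneous parts. -/
abbrev tensorDecomposition (M : GSMod.{t, u₂, w} 𝒜₂) : Decomposition (P.tensorGrading M) :=
  Decomposition.ofAddHom _ (P.tensorLift M (P.tensorSplit M) (P.tensorSplit_balanced M))
    (by
      ext z
      refine P.tensor_induction (p := fun z => ((DirectSum.coeAddMonoidHom (P.tensorGrading M)).comp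
          (P.tensorLift M (P.tensorSplit M) (P.tensorSplit_balanced M))) z = AddMonoidHom.id _ z)
        (by simp only [map_zero]) (fun y z hy hz => by rw [map_add, hy, hz, map_add])
        (fun x m => ?_) z
      rw [AddMonoidHom.comp_apply, tensorLift_tmul, AddMonoidHom.id_apply]
      induction x using Decomposition.inductionOn P.grading with
      | zero => simp [tmul]
      | add x y hx hy => rw [map_add, AddMonoidHom.add_apply, map_add, hx, hy, add_tmul]
      | homogeneous x =>
        induction m using Decomposition.inductionOn M.grading with
        | zero => simp [tmul]
        | add m n hm hn => rw [map_add, map_add, hm, hn, tmul_add]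
        | homogeneous m => rw [P.tensorSplit_of_mem M x.2 m.2, coeAddMonoidHom_of])
    (by
      ext d ⟨z, hz⟩ : 2
      simp only [AddMonoidHom.comp_apply, coeAddMonoidHom_of, AddMonoidHom.id_apply]
      induction hz using AddSubgroup.closure_induction with
      | mem z hz =>
        obtain ⟨i, k, x, m, rfl, hx, hm, rfl⟩ := hz
        rw [tensorLift_tmul, P.tensorSplit_of_mem M hx hm]
      | zero => rw [map_zero]; exact (map_zero _).symm
      | add y z hy hz ihy ihz => rw [map_add, ihy, ihz, ← map_add]; rfl
      | neg y hy ih => rw [map_neg, ih, ← map_neg]; rfl)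

/-- The graded supermodule `P ⊗_{A₂} M`. -/
def tensorObj (M : GSMod.{t, u₂, w} 𝒜₂) : GSMod.{t, u₁, max v w} 𝒜₁ where
  carrier := P.TensorCarrier M
  grading := P.tensorGrading M
  decomposition := P.tensorDecomposition M
  smul_mem := by
    intro i d a z ha hz
    induction hz using AddSubgroup.closure_induction with
    | mem z hz =>
      obtain ⟨k, l, x, m, rfl, hx, hm, rfl⟩ := hz
      rw [smul_tmul, ← add_assoc]
      exact tmul_mem (P.smul_mem ha hx) hm
    | zero => rw [smul_zero]; exact zero_mem _
    | add y z _ _ hy hz => rw [smul_add]; exact add_mem hy hz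
    | neg y _ hy => rw [smul_neg]; exact neg_mem hy

/-- The map `x ⊗ m ↦ x ⊗ f(m)`. -/
def tensorMap {M N : GSMod.{t, u₂, w} 𝒜₂} (f : M ⟶ N) :
    P.TensorCarrier M →ₗ[A₁] P.TensorCarrier N :=
  Submodule.mapQ (P.tensorRel M) (P.tensorRel N)
    (TensorProduct.AlgebraTensorModule.lTensor A₁ P.carrier (f.toLinearMap.restrictScalars ℤ))
    (by
      rw [tensorRel, Submodule.span_le]
      rintro _ ⟨x, a, m, rfl⟩
      exact Submodule.subset_span ⟨x, a, f.toLinearMap m, by simp⟩)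

theorem tensorMap_tmul {M N : GSMod.{t, u₂, w} 𝒜₂} (f : M ⟶ N) (x : P.carrier) (m : M.carrier) :
    P.tensorMap f (P.tmul M x m) = P.tmul N x (f.toLinearMap m) := rfl

theorem tensorMap_mem {M N : GSMod.{t, u₂, w} 𝒜₂} (f : M ⟶ N) (d : Λ × ZMod 2)
    (z : P.TensorCarrier M) (hz : z ∈ P.tensorGrading M d) :
    P.tensorMap f z ∈ P.tensorGrading N d := by
  induction hz using AddSubgroup.closure_induction with
  | mem z hz =>
    obtain ⟨i, k, x, m, rfl, hx, hm, rfl⟩ := hz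
    exact tmul_mem hx (f.map_mem k m hm)
  | zero => rw [map_zero]; exact zero_mem _
  | add y z _ _ hy hz => rw [map_add]; exact add_mem hy hz
  | neg y _ hy => rw [map_neg]; exact neg_mem hy

theorem tensorMap_id (M : GSMod.{t, u₂, w} 𝒜₂) : P.tensorMap (𝟙 M) = LinearMap.id :=
  LinearMap.ext fun z => P.tensor_induction (p := fun z => P.tensorMap (𝟙 M) z = z) (map_zero _)
    (fun y z hy hz => by rw [map_add, hy, hz]) (fun _ _ => rfl) z

theorem tensorMap_comp {L M N : GSMod.{t, u₂, w} 𝒜₂} (f : L ⟶ M) (g : M ⟶ N) :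
    P.tensorMap (f ≫ g) = (P.tensorMap g).comp (P.tensorMap f) :=
  LinearMap.ext fun z => P.tensor_induction
    (p := fun z => P.tensorMap (f ≫ g) z = P.tensorMap g (P.tensorMap f z))
    (by simp only [map_zero]) (fun y z hy hz => by simp only [map_add, hy, hz])
    (fun _ _ => rfl) z

/-- The functor `P ⊗_{A₂} -`. -/
def tensorFunctor : GSMod.{t, u₂, w} 𝒜₂ ⥤ GSMod.{t, u₁, max v w} 𝒜₁ where
  obj M := P.tensorObj M
  map f := ⟨P.tensorMap f, P.tensorMap_mem f⟩
  map_id M := GSMod.Hom.ext (P.tensorMap_id M)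
  map_comp f g := GSMod.Hom.ext (P.tensorMap_comp f g)

end GSBimod

/-! ### Twisted Frobenius extensions -/

section Frobenius

variable {A : Type u₁} [Ring A] {𝒜 : Λ × ZMod 2 → AddSubgroup A} [GradedRing 𝒜]
  {B : Type u₂} [Ring B] {ℬ : Λ × ZMod 2 → AddSubgroup B} [GradedRing ℬ]

/-- `tr` is a trace map that makes `A` an `(α, β)`-Frobenius extension of degree `(-lam, p)` of
the subring `j : B → A`. -/
structure IsTwistedFrobeniusWith (j : ℬ →+*ᵍ 𝒜) (α : 𝒜 →+*ᵍ 𝒜) (β : ℬ →+*ᵍ ℬ) (lam : Λ)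
    (p : ZMod 2) (tr : A →+ B) : Prop where
  /-- `B` is a subring of `A`; `α` and `β` are automorphisms. -/
  injective : Function.Injective j
  bijective_left : Function.Bijective α
  bijective_right : Function.Bijective β
  /-- `A` is finitely generated and projective as a left `B`-module. -/
  finite : Module.Finite B (GSMod.ofHom j).carrier
  projective : Module.Projective B (GSMod.ofHom j).carrier
  /-- `tr` is a morphism of `(B, B)`-bimodules from `^β_B A_B^α` to `{lam, p} B`. -/
  map_mem : ∀ (i : Λ × ZMod 2) (a : A), a ∈ 𝒜 i → tr a ∈ ℬ (i - (lam, p))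
  map_left : ∀ (i : Λ × ZMod 2) (b : B) (a : A), b ∈ ℬ i →
    tr (j (β b) * a) = ((-1 : ℤˣ) ^ (p * i.2)) • (b * tr a)
  map_right : ∀ (a : A) (b : B), tr (a * α (j b)) = tr a * b
  /-- If `tr (A a) = 0`, then `a = 0`. -/
  eq_zero : ∀ a : A, (∀ c : A, tr (c * a) = 0) → a = 0
  /-- Every `φ` in `HOM_B(^β_B A, {lam, p} B)` is of the form `tr ∘ ʳa`. -/
  exists_eq : ∀ φ : A →+ B,
    φ ∈ GSMod.HOM (GSMod.ofHom (j.comp β)) (GSMod.shift lam p (GSMod.ofHom (GradedRingHom.id ℬ))) →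
      ∃ a : A, φ = tr.comp (rightOp 𝒜 a)

/-- `A` is an `(α, β)`-Frobenius extension of degree `(-lam, p)` of the subring `j : B → A`. -/
def IsTwistedFrobenius (j : ℬ →+*ᵍ 𝒜) (α : 𝒜 →+*ᵍ 𝒜) (β : ℬ →+*ᵍ ℬ) (lam : Λ)
    (p : ZMod 2) : Prop :=
  ∃ tr : A →+ B, IsTwistedFrobeniusWith j α β lam p tr

/-- `tr` is a trace map that makes `A` an untwisted Frobenius extension of degree `(-lam, p)`. -/
abbrev IsFrobeniusWith (j : ℬ →+*ᵍ 𝒜) (lam : Λ) (p : ZMod 2) (tr : A →+ B) : Prop :=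
  IsTwistedFrobeniusWith j (GradedRingHom.id 𝒜) (GradedRingHom.id ℬ) lam p tr

/-- `ψ` is the Nakayama automorphism of an untwisted Frobenius extension with trace map
`tr : A → B`, in the case where the centralizer of the subring `B` is all of `A`. -/
structure IsNakayama (tr : A →+ B) (ψ : 𝒜 →+*ᵍ 𝒜) : Prop where
  bijective : Function.Bijective ψ
  trace_mul : ∀ (i k : Λ × ZMod 2) (a c : A), a ∈ 𝒜 i → c ∈ 𝒜 k →
    tr (c * a) = ((-1 : ℤˣ) ^ (i.2 * k.2)) • tr (a * ψ c)

/-- `x` and `y` are dual sets of generators of `A` over the subring `j : B → A`, with respect to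
a trace map `tr` of degree `(-lam, p)`; the degree of `x s` is `dx s`. -/
structure IsDualGenerators (j : ℬ →+*ᵍ 𝒜) (lam : Λ) (p : ZMod 2) (tr : A →+ B) {n : ℕ}
    (dx : Fin n → Λ × ZMod 2) (x y : Fin n → A) : Prop where
  mem_left : ∀ s, x s ∈ 𝒜 (dx s)
  mem_right : ∀ s, y s ∈ 𝒜 ((lam, p) - dx s)
  left_expansion : ∀ (i : Λ × ZMod 2) (a : A), a ∈ 𝒜 i →
    a = ((-1 : ℤˣ) ^ (p * i.2)) •
      ∑ s, ((-1 : ℤˣ) ^ (p * (dx s).2)) • (j (tr (a * y s)) * x s)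
  right_expansion : ∀ a : A, a = ∑ s, y s * j (tr (x s * a))

/-- The induction functor `_A A_B ⊗_B -`. -/
def inductionFunctor (j : ℬ →+*ᵍ 𝒜) : GSMod.{t, u₂, max u₁ w} ℬ ⥤ GSMod.{t, u₁, max u₁ w} 𝒜 :=
  (GSBimod.ofHoms (GradedRingHom.id 𝒜) j).tensorFunctor

/-- The shifted twisted restriction functor `{lam, p} ^β_B A^α_A ⊗_A -`. -/
def shiftedTwistedRestriction (j : ℬ →+*ᵍ 𝒜) (α : 𝒜 →+*ᵍ 𝒜) (β : ℬ →+*ᵍ ℬ) (lam : Λ)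
    (p : ZMod 2) : GSMod.{t, u₁, max u₁ w} 𝒜 ⥤ GSMod.{t, u₂, max u₁ w} ℬ :=
  (GSBimod.ofHoms (j.comp β) α).tensorFunctor ⋙ GSMod.shiftFunctor lam p

end Frobenius

end NestedFrobenius

end

/-!
Since `B` is a Frobenius extension of `R`, every right `R`-linear map `B → R` is `b ↦ trB (c * b)`
for a unique `c`. Applied to the maps `b ↦ trA (a * ψA b)`, this gives a map `tr : A → B` with
`trB (tr a * b) = trA (a * ψA b)` for all `b`. Testing against `trB` transfers to `tr` the degree,
the bimodule property, the nondegeneracy and the surjectivity that hold for `trA`, and the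
expansion of `tr a` in dual generators of `B` is the explicit formula for the trace.

A homogeneous dual basis of the projective `B`-module `A`, rewritten in terms of the trace, consists
of generators `x s` and `y s` with `∑ s, y s * tr (x s * α a) = a`. The unit
`m ↦ ∑ s, y s ⊗ (x s ⊗ m)` and the counit `a ⊗ (a' ⊗ n) ↦ tr (a * α a') n` then form an adjunction.
-/

noncomputable section

namespace NestedFrobenius

/-! ### Homogeneous components -/

section Components

variable {ι M : Type*} [DecidableEq ι] [AddCommGroup M] (ℳ : ι → AddSubgroup M)
  [Decomposition ℳ]

/-- The projection of a graded group onto its part of degree `i`, as an endomorphism of the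
whole group. -/
def component (i : ι) : M →+ M :=
  ((ℳ i).subtype.comp (DFinsupp.evalAddMonoidHom i)).comp (decomposeAddEquiv ℳ).toAddMonoidHom

theorem component_apply (i : ι) (m : M) : component ℳ i m = decompose ℳ m i := rfl

theorem component_mem (i : ι) (m : M) : component ℳ i m ∈ ℳ i := (decompose ℳ m i).2

theorem component_of_mem {i : ι} {m : M} (hm : m ∈ ℳ i) : component ℳ i m = m :=
  decompose_of_mem_same ℳ hm

theorem component_of_mem_ne {i k : ι} {m : M} (hm : m ∈ ℳ i) (h : i ≠ k) :
    component ℳ k m = 0 :=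
  decompose_of_mem_ne ℳ hm h

theorem eq_zero_of_component_eq_zero {m : M} (h : ∀ i, component ℳ i m = 0) : m = 0 :=
  (decompose ℳ).injective <| DFinsupp.ext fun i => Subtype.ext <| by
    rw [← component_apply, h, decompose_zero]
    rfl

variable {κ N : Type*} [DecidableEq κ] [AddCommGroup N] (𝒩 : κ → AddSubgroup N)
  [Decomposition 𝒩]

variable {ℳ 𝒩} in
theorem component_map {σ : ι → κ} (hσ : Function.Injective σ) {f : M →+ N}
    (hf : ∀ i, ∀ m ∈ ℳ i, f m ∈ 𝒩 (σ i)) (i : ι) (m : M) :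
    component 𝒩 (σ i) (f m) = f (component ℳ i m) := by
  induction m using Decomposition.inductionOn ℳ with
  | zero => simp
  | add m m' hm hm' => simp only [map_add, hm, hm']
  | @homogeneous k m =>
    obtain rfl | h := eq_or_ne k i
    · rw [component_of_mem _ (hf _ _ m.2), component_of_mem _ m.2]
    · rw [component_of_mem_ne _ (hf _ _ m.2) (hσ.ne h), component_of_mem_ne _ m.2 h, map_zero]

end Components

section DegreePart

variable {Γ M N : Type*} [DecidableEq Γ] [AddCommGroup M] [AddCommGroup N]
  (ℳ : Γ → AddSubgroup M) [Decomposition ℳ] (𝒩 : Γ → AddSubgroup N) [Decomposition 𝒩]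

/-- The part of degree `d` of an additive map between graded groups. -/
def degreePart [Add Γ] (d : Γ) (f : M →+ N) : M →+ N :=
  (DirectSum.toAddMonoid fun i => ((component 𝒩 (i + d)).comp f).comp (ℳ i).subtype).comp
    (decomposeAddEquiv ℳ).toAddMonoidHom

theorem degreePart_of_mem [Add Γ] (d : Γ) (f : M →+ N) {i : Γ} {m : M} (hm : m ∈ ℳ i) :
    degreePart ℳ 𝒩 d f m = component 𝒩 (i + d) (f m) := by
  simp [degreePart, decompose_of_mem ℳ hm]

end DegreePart

section GradedModule

variable {Γ B M N : Type*} [AddGroup Γ] [DecidableEq Γ] [Ring B] (ℬ : Γ → AddSubgroup B)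
  [AddCommGroup M] [Module B M] (ℳ : Γ → AddSubgroup M) [Decomposition ℳ]
  [SetLike.GradedSMul ℬ ℳ]

theorem component_smul_of_mem_left {k : Γ} {b : B} (hb : b ∈ ℬ k) (i : Γ) (m : M) :
    component ℳ (k + i) (b • m) = b • component ℳ i m :=
  component_map (f := DistribSMul.toAddMonoidHom M b) (add_right_injective k)
    (fun _ _ hm => SetLike.GradedSMul.smul_mem hb hm) i m

variable [GradedRing ℬ]

theorem component_smul_of_mem_right {k : Γ} {m : M} (hm : m ∈ ℳ k) (i : Γ) (b : B) :
    component ℳ (i + k) (b • m) = component ℬ i b • m :=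
  component_map (f := (smulAddHom B M).flip m) (add_left_injective k)
    (fun _ _ hb => SetLike.GradedSMul.smul_mem hb hm) i b

theorem degreePart_smul [AddCommGroup N] [Module B N] (𝒩 : Γ → AddSubgroup N) [Decomposition 𝒩]
    [SetLike.GradedSMul ℬ 𝒩] (d : Γ) (f : M →ₗ[B] N) (b : B) (m : M) :
    degreePart ℳ 𝒩 d f.toAddMonoidHom (b • m) = b • degreePart ℳ 𝒩 d f.toAddMonoidHom m := by
  induction b using Decomposition.inductionOn ℬ with
  | zero => simp
  | add b b' hb hb' => simp only [add_smul, map_add, hb, hb']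
  | @homogeneous k b =>
    induction m using Decomposition.inductionOn ℳ with
    | zero => simp
    | add m m' hm hm' => simp only [smul_add, map_add, hm, hm']
    | @homogeneous i m =>
      have hbm : (b : B) • (m : M) ∈ ℳ (k + i) := SetLike.GradedSMul.smul_mem b.2 m.2
      rw [degreePart_of_mem _ _ _ _ hbm, degreePart_of_mem _ _ _ _ m.2, add_assoc,
        ← component_smul_of_mem_left ℬ 𝒩 b.2]
      exact congrArg _ (f.map_smul _ _)

omit [AddGroup Γ] [SetLike.GradedSMul ℬ ℳ] [GradedRing ℬ] in
variable (B) in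
theorem span_isHomogeneousElem_eq_top :
    Submodule.span B {m : M | SetLike.IsHomogeneousElem ℳ m} = ⊤ := by
  refine eq_top_iff.2 fun m _ => ?_
  induction m using Decomposition.inductionOn ℳ with
  | zero => exact zero_mem _
  | add m m' hm hm' => exact add_mem (hm trivial) (hm' trivial)
  | homogeneous m => exact Submodule.subset_span ⟨_, m.2⟩

omit [AddGroup Γ] [SetLike.GradedSMul ℬ ℳ] [GradedRing ℬ] in
variable (B) in
theorem exists_homogeneous_generators [Module.Finite B M] :
    ∃ (n : ℕ) (d : Fin n → Γ) (e : Fin n → M),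
      (∀ s, e s ∈ ℳ (d s)) ∧ Submodule.span B (Set.range e) = ⊤ := by
  have hfg : (Submodule.span B {m : M | SetLike.IsHomogeneousElem ℳ m}).FG := by
    rw [span_isHomogeneousElem_eq_top]
    exact Module.Finite.fg_top
  obtain ⟨S, hS, hspan⟩ := (Submodule.fg_span_iff_fg_span_finset_subset _).1 hfg
  choose d hd using hS
  let ε := S.equivFin.symm
  have hε : Set.range (fun s => (ε s : M)) = S :=
    (EquivLike.range_comp ((↑) : S → M) ε).trans Subtype.range_coe
  refine ⟨S.card, fun s => d (ε s).2, fun s => ε s, fun s => hd (ε s).2, ?_⟩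
  rw [hε, ← hspan, span_isHomogeneousElem_eq_top]

theorem exists_linearMap_eq_component [AddCommGroup N] [Module B N] (𝒩 : Γ → AddSubgroup N)
    [Decomposition 𝒩] [SetLike.GradedSMul ℬ 𝒩] (d : Γ) (f : M →ₗ[B] N) :
    ∃ g : M →ₗ[B] N, ∀ i, ∀ m ∈ ℳ i, g m = component 𝒩 (i + d) (f m) :=
  ⟨{ toFun := degreePart ℳ 𝒩 d f.toAddMonoidHom
     map_add' := map_add _
     map_smul' := degreePart_smul ℬ ℳ 𝒩 d f },
    fun _ _ hm => degreePart_of_mem ℳ 𝒩 d f.toAddMonoidHom hm⟩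

theorem exists_homogeneous_dualBasis [Module.Finite B M] [Module.Projective B M] :
    ∃ (n : ℕ) (d : Fin n → Γ) (e : Fin n → M) (f : Fin n → M →ₗ[B] B),
      (∀ s, e s ∈ ℳ (d s)) ∧ (∀ s i, ∀ m ∈ ℳ i, f s m ∈ ℬ (i - d s)) ∧
        ∀ m, ∑ s, f s m • e s = m := by
  obtain ⟨n, d, e, he, hspan⟩ := exists_homogeneous_generators B ℳ
  obtain ⟨g, hg⟩ := Module.projective_lifting_property (Fintype.linearCombination B e)
    (LinearMap.id : M →ₗ[B] M)
    (LinearMap.range_eq_top.1 (by rw [Fintype.range_linearCombination, hspan]))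
  choose f hf using fun s =>
    exists_linearMap_eq_component ℬ ℳ ℬ (-d s) (LinearMap.proj s ∘ₗ g)
  simp only [← sub_eq_add_neg, LinearMap.comp_apply, LinearMap.proj_apply] at hf
  refine ⟨n, d, e, f, he, fun s i m hm => hf s i m hm ▸ component_mem _ _ _, fun m => ?_⟩
  induction m using Decomposition.inductionOn ℳ with
  | zero => simp
  | add m m' hm hm' => simp only [map_add, add_smul, Finset.sum_add_distrib, hm, hm']
  | @homogeneous i m =>
    calc ∑ s, f s m • e s = component ℳ i (∑ s, g m s • e s) := by
          rw [map_sum]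
          refine Finset.sum_congr rfl fun s _ => ?_
          rw [hf s i m m.2, ← component_smul_of_mem_right ℬ ℳ (he s), sub_add_cancel]
      _ = component ℳ i m := congrArg _ (DFunLike.congr_fun hg (m : M))
      _ = m := component_of_mem ℳ m.2

end GradedModule

theorem mem_of_map_mem_of_injective {Γ A B : Type*} [Ring A] [Ring B] [AddMonoid Γ]
    [DecidableEq Γ] {𝒜 : Γ → AddSubgroup A} {ℬ : Γ → AddSubgroup B} [GradedRing 𝒜] [GradedRing ℬ]
    {f : 𝒜 →+*ᵍ ℬ} (hf : Function.Injective f) {i : Γ} {a : A} (ha : f a ∈ ℬ i) : a ∈ 𝒜 i := by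
  have h : f (component 𝒜 i a) = f a := by
    rw [component_apply, GradedRingHom.map_directSumDecompose, decompose_of_mem_same ℬ ha]
  exact hf h ▸ component_mem 𝒜 i a

variable {Λ : Type t} [AddCommGroup Λ] [DecidableEq Λ]

/-! ### Sign rules -/

instance {B : Type u} [Ring B] {ℬ : Λ × ZMod 2 → AddSubgroup B} (M : GSMod.{t, u, w} ℬ) :
    SetLike.GradedSMul ℬ M.grading :=
  ⟨fun _ _ _ _ hb hm => M.smul_mem hb hm⟩

section Signs

variable {M : Type*} [AddCommGroup M]

theorem units_smul_mem (ε : ℤˣ) {S : AddSubgroup M} {m : M} (hm : m ∈ S) : ε • m ∈ S := by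
  rw [Units.smul_def]
  exact zsmul_mem hm _

theorem neg_one_uzpow_smul_smul (p q : ZMod 2) (m : M) :
    ((-1 : ℤˣ) ^ p) • ((-1 : ℤˣ) ^ q) • m = ((-1 : ℤˣ) ^ (p + q)) • m := by
  rw [smul_smul, uzpow_add]

theorem neg_one_uzpow_smul_self (p : ZMod 2) (m : M) :
    ((-1 : ℤˣ) ^ p) • ((-1 : ℤˣ) ^ p) • m = m := by
  rw [smul_smul, Int.units_mul_self, one_smul]

variable {A : Type*} [Ring A] {𝒜 : Λ × ZMod 2 → AddSubgroup A} [GradedRing 𝒜]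
  {B : Type*} [Ring B] {ℬ : Λ × ZMod 2 → AddSubgroup B} [GradedRing ℬ]

theorem signHom_mem (p : ZMod 2) {i : Λ × ZMod 2} {a : A} (ha : a ∈ 𝒜 i) :
    signHom 𝒜 p a ∈ 𝒜 i := by
  rw [signHom_of_mem 𝒜 p ha]
  exact units_smul_mem _ ha

theorem signHom_signHom (p q : ZMod 2) (a : A) :
    signHom 𝒜 p (signHom 𝒜 q a) = signHom 𝒜 (p + q) a := by
  induction a using Decomposition.inductionOn 𝒜 with
  | zero => simp
  | add a b ha hb => simp only [map_add, ha, hb]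
  | homogeneous a =>
    rw [signHom_of_mem 𝒜 p (signHom_mem q a.2), signHom_of_mem 𝒜 q a.2,
      signHom_of_mem 𝒜 _ a.2, neg_one_uzpow_smul_smul, add_mul]

theorem signHom_zero (a : A) : signHom 𝒜 0 a = a := by
  induction a using Decomposition.inductionOn 𝒜 with
  | zero => simp
  | add a b ha hb => simp only [map_add, ha, hb]
  | homogeneous a => rw [signHom_of_mem 𝒜 0 a.2, zero_mul, uzpow_zero, one_smul]

theorem signHom_signHom_self (p : ZMod 2) (a : A) : signHom 𝒜 p (signHom 𝒜 p a) = a := by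
  rw [signHom_signHom, CharTwo.add_self_eq_zero, signHom_zero]

theorem signHom_map_of_degree {d : Λ × ZMod 2} {f : A →+ B}
    (hf : ∀ i, ∀ a ∈ 𝒜 i, f a ∈ ℬ (i - d)) (p : ZMod 2) (a : A) :
    signHom ℬ p (f a) = ((-1 : ℤˣ) ^ (p * d.2)) • f (signHom 𝒜 p a) := by
  induction a using Decomposition.inductionOn 𝒜 with
  | zero => simp
  | add a b ha hb => simp only [map_add, smul_add, ha, hb]
  | @homogeneous i a =>
    rw [signHom_of_mem ℬ p (hf i a a.2), signHom_of_mem 𝒜 p a.2, map_zsmul_unit,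
      neg_one_uzpow_smul_smul, Prod.snd_sub, CharTwo.sub_eq_add, mul_add, add_comm]

theorem map_signHom (f : 𝒜 →+*ᵍ ℬ) (p : ZMod 2) (a : A) :
    f (signHom 𝒜 p a) = signHom ℬ p (f a) := by
  induction a using Decomposition.inductionOn 𝒜 with
  | zero => simp
  | add a b ha hb => simp only [map_add, ha, hb]
  | homogeneous a =>
    rw [signHom_of_mem 𝒜 p a.2, signHom_of_mem ℬ p (GradedFunLike.map_mem f a.2),
      map_zsmul_unit]

theorem rightOp_of_mem_left {i : Λ × ZMod 2} {a : A} (ha : a ∈ 𝒜 i) (m : A) :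
    rightOp 𝒜 a m = signHom 𝒜 i.2 m * a := by
  induction m using Decomposition.inductionOn 𝒜 with
  | zero => simp
  | add m n hm hn => simp only [map_add, add_mul, hm, hn]
  | homogeneous m => rw [rightOp_of_mem 𝒜 ha m.2, signHom_of_mem 𝒜 _ m.2, smul_mul_assoc]

theorem rightOp_of_mem_right {k : Λ × ZMod 2} {m : A} (hm : m ∈ 𝒜 k) (a : A) :
    rightOp 𝒜 a m = m * signHom 𝒜 k.2 a := by
  induction a using Decomposition.inductionOn 𝒜 with
  | zero => simp
  | add a b ha hb => simp only [map_add, AddMonoidHom.add_apply, mul_add, ha, hb]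
  | homogeneous a =>
    rw [rightOp_of_mem 𝒜 a.2 hm, signHom_of_mem 𝒜 _ a.2, mul_smul_comm, mul_comm]

theorem rightOp_mem {i k : Λ × ZMod 2} {a m : A} (ha : a ∈ 𝒜 i) (hm : m ∈ 𝒜 k) :
    rightOp 𝒜 a m ∈ 𝒜 (k + i) := by
  rw [rightOp_of_mem_left ha]
  exact SetLike.mul_mem_graded (signHom_mem _ hm) ha

theorem map_rightOp (f : 𝒜 →+*ᵍ ℬ) (a m : A) : f (rightOp 𝒜 a m) = rightOp ℬ (f a) (f m) := by
  induction a using Decomposition.inductionOn 𝒜 with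
  | zero => simp
  | add a b ha hb => simp only [map_add, AddMonoidHom.add_apply, ha, hb]
  | homogeneous a =>
    rw [rightOp_of_mem_left a.2, map_mul, map_signHom,
      rightOp_of_mem_left (GradedFunLike.map_mem f a.2)]

theorem rightOp_mul {k l : Λ × ZMod 2} {c d : A} (hc : c ∈ 𝒜 k) (hd : d ∈ 𝒜 l) (m : A) :
    rightOp 𝒜 (c * d) m = ((-1 : ℤˣ) ^ (k.2 * l.2)) • rightOp 𝒜 d (rightOp 𝒜 c m) := by
  rw [rightOp_of_mem_left (SetLike.mul_mem_graded hc hd), rightOp_of_mem_left hd,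
    rightOp_of_mem_left hc, map_mul, signHom_signHom, signHom_of_mem 𝒜 _ hc, mul_smul_comm,
    smul_mul_assoc, mul_comm l.2, neg_one_uzpow_smul_self, Prod.snd_add, add_comm k.2, mul_assoc]

theorem rightOp_mul_right {k l : Λ × ZMod 2} {c d : A} (hc : c ∈ 𝒜 k) (hd : d ∈ 𝒜 l) (m : A) :
    rightOp 𝒜 c (d * m) = ((-1 : ℤˣ) ^ (k.2 * l.2)) • (d * rightOp 𝒜 c m) := by
  rw [rightOp_of_mem_left hc, rightOp_of_mem_left hc, map_mul, signHom_of_mem 𝒜 _ hd,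
    smul_mul_assoc, smul_mul_assoc, mul_assoc]

end Signs

section Supercentral

variable {A : Type*} [Ring A] {𝒜 : Λ × ZMod 2 → AddSubgroup A} [GradedRing 𝒜]
  {R : Type*} [Ring R] {ℛ : Λ × ZMod 2 → AddSubgroup R} [GradedRing ℛ]
  {j : ℛ →+*ᵍ 𝒜}

theorem superCentralizer_eq_top_iff :
    superCentralizer j = ⊤ ↔ ∀ a r, rightOp 𝒜 a (j r) = a * j r := by
  have key {k l : Λ × ZMod 2} {a : A} {r : R} (ha : a ∈ 𝒜 k) (hr : r ∈ ℛ l) :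
      rightOp 𝒜 a (j r) = a * j r ↔ a * j r = ((-1 : ℤˣ) ^ (k.2 * l.2)) • (j r * a) := by
    rw [rightOp_of_mem 𝒜 ha (GradedFunLike.map_mem j hr), eq_comm]
  refine ⟨fun h a r => ?_, fun h => eq_top_iff.2 fun a _ k l r hr =>
    (key (component_mem 𝒜 k a) hr).1 (h _ r)⟩
  induction a using Decomposition.inductionOn 𝒜 with
  | zero => simp
  | add a b ha hb => simp only [map_add, AddMonoidHom.add_apply, add_mul, ha, hb]
  | @homogeneous k a =>
    induction r using Decomposition.inductionOn ℛ with
    | zero => simp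
    | add r s hr hs => simp only [map_add, mul_add, hr, hs]
    | @homogeneous l r =>
      have ha : (a : A) ∈ superCentralizer j := h ▸ AddSubgroup.mem_top _
      rw [key a.2 r.2]
      simpa only [decompose_of_mem_same 𝒜 a.2] using ha k l r r.2

variable (hj : superCentralizer j = ⊤)
include hj

theorem rightOp_map (a : A) (r : R) : rightOp 𝒜 a (j r) = a * j r :=
  superCentralizer_eq_top_iff.1 hj a r

theorem map_mul_eq {k : Λ × ZMod 2} {a : A} (ha : a ∈ 𝒜 k) (r : R) :
    a * j r = j (signHom ℛ k.2 r) * a := by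
  rw [← rightOp_map hj, rightOp_of_mem_left ha, map_signHom]

theorem map_rightOp_eq (r : R) (a : A) : rightOp 𝒜 (j r) a = j r * a := by
  induction a using Decomposition.inductionOn 𝒜 with
  | zero => simp
  | add a b ha hb => simp only [map_add, mul_add, ha, hb]
  | homogeneous a =>
    rw [rightOp_of_mem_right a.2, ← map_signHom, map_mul_eq hj a.2, signHom_signHom_self]

theorem rightOp_mul_map (c a : A) (r : R) :
    rightOp 𝒜 c (a * j r) = rightOp 𝒜 c a * j r := by
  induction c using Decomposition.inductionOn 𝒜 with
  | zero => simp
  | add c d hc hd => simp only [map_add, AddMonoidHom.add_apply, add_mul, hc, hd]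
  | homogeneous c =>
    rw [rightOp_of_mem_left c.2, rightOp_of_mem_left c.2, map_mul, ← map_signHom, mul_assoc,
      mul_assoc, map_mul_eq hj c.2]

omit hj in
theorem superCentralizer_eq_top_of_comp {B : Type*} [Ring B] {ℬ : Λ × ZMod 2 → AddSubgroup B}
    [GradedRing ℬ] {i : ℛ →+*ᵍ ℬ} {f : ℬ →+*ᵍ 𝒜} (hf : Function.Injective f)
    (h : superCentralizer (f.comp i) = ⊤) : superCentralizer i = ⊤ :=
  superCentralizer_eq_top_iff.2 fun b r => hf <| by
    rw [map_rightOp, map_mul]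
    exact rightOp_map h (f b) r

end Supercentral

/-! ### Dual bases of twisted Frobenius extensions -/

section Frobenius

variable {A : Type u₁} [Ring A] {𝒜 : Λ × ZMod 2 → AddSubgroup A} [GradedRing 𝒜]
  {B : Type u₂} [Ring B] {ℬ : Λ × ZMod 2 → AddSubgroup B} [GradedRing ℬ]

theorem mem_homDeg_shift_iff {f : ℬ →+*ᵍ 𝒜} {lam : Λ} {p : ZMod 2} {d : Λ × ZMod 2}
    {φ : A →+ B} :
    φ ∈ GSMod.homDeg (GSMod.ofHom f) (GSMod.shift lam p (GSMod.ofHom (GradedRingHom.id ℬ))) d ↔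
      (∀ i, ∀ c ∈ 𝒜 i, φ c ∈ ℬ (d + i - (lam, p))) ∧
        ∀ b c, φ (f b * c) = signHom ℬ (p + d.2) b * φ c := by
  have key {i : Λ × ZMod 2} {b : B} (hb : b ∈ ℬ i) (c : A) :
      ((-1 : ℤˣ) ^ (d.2 * i.2)) • (signHom ℬ p b * φ c) = signHom ℬ (p + d.2) b * φ c := by
    rw [signHom_of_mem ℬ p hb, signHom_of_mem ℬ _ hb, smul_mul_assoc, smul_mul_assoc,
      neg_one_uzpow_smul_smul, ← add_mul, add_comm]
  refine and_congr_right fun _ => ⟨fun h b c => ?_, fun h i b c hb => (h b c).trans (key hb c).symm⟩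
  induction b using Decomposition.inductionOn ℬ with
  | zero => simp
  | add b b' hb hb' => simp only [map_add, add_mul, hb, hb']
  | homogeneous b => exact (h _ b c b.2).trans (key b.2 c)

/-- The twisted dual sets of generators `x`, `y` of an `(α, β)`-Frobenius extension with trace
map `tr` of degree `(-lam, p)`; the degree of `x s` is `d s`. The element dual to `x s` for `tr`
is `α (y s)`; writing it in this way avoids `α⁻¹` in `sum_right`. -/
structure IsTwistedDualGenerators (j : ℬ →+*ᵍ 𝒜) (α : 𝒜 →+*ᵍ 𝒜) (β : ℬ →+*ᵍ ℬ) (lam : Λ)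
    (p : ZMod 2) (tr : A →+ B) {n : ℕ} (d : Fin n → Λ × ZMod 2) (x y : Fin n → A) : Prop where
  mem_left : ∀ s, x s ∈ 𝒜 (d s)
  mem_right : ∀ s, y s ∈ 𝒜 ((lam, p) - d s)
  sum_left : ∀ a, ∑ s, j (β (signHom ℬ p (tr (a * α (y s))))) * x s = a
  sum_right : ∀ a, ∑ s, y s * j (tr (x s * α a)) = a

namespace IsTwistedFrobeniusWith

variable {j : ℬ →+*ᵍ 𝒜} {α : 𝒜 →+*ᵍ 𝒜} {β : ℬ →+*ᵍ ℬ} {lam : Λ} {p : ZMod 2} {tr : A →+ B}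
  (h : IsTwistedFrobeniusWith j α β lam p tr)
include h

theorem trace_left_mul (b : B) (a : A) : tr (j (β b) * a) = signHom ℬ p b * tr a := by
  induction b using Decomposition.inductionOn ℬ with
  | zero => simp
  | add b c hb hc => simp only [map_add, add_mul, hb, hc]
  | homogeneous b => rw [h.map_left _ b a b.2, signHom_of_mem ℬ p b.2, smul_mul_assoc]

theorem eq_of_trace_mul_eq {a b : A} (hab : ∀ c, tr (c * a) = tr (c * b)) : a = b :=
  sub_eq_zero.1 <| h.eq_zero _ fun c => by rw [mul_sub, map_sub, hab, sub_self]

theorem component_trace_rightOp {k : Λ × ZMod 2} {c : A} (hc : c ∈ 𝒜 k) (i : Λ × ZMod 2)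
    (a : A) : component ℬ (i + k - (lam, p)) (tr (rightOp 𝒜 a c)) =
      tr (rightOp 𝒜 (component 𝒜 i a) c) :=
  component_map (f := tr.comp ((rightOp 𝒜).flip c)) (σ := fun i => i + k - (lam, p))
    (sub_left_injective.comp (add_left_injective k))
    (fun i _ ha => h.map_mem _ _ (add_comm k i ▸ rightOp_mem ha hc)) i a

theorem eq_of_trace_rightOp_eq {a b : A}
    (hab : ∀ c, tr (rightOp 𝒜 a c) = tr (rightOp 𝒜 b c)) : a = b := by
  refine sub_eq_zero.1 (eq_zero_of_component_eq_zero 𝒜 fun i => h.eq_zero _ fun c => ?_)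
  induction c using Decomposition.inductionOn 𝒜 with
  | zero => simp
  | add c d hc hd => rw [add_mul, map_add, hc, hd, add_zero]
  | @homogeneous k c =>
    have hzero : tr (rightOp 𝒜 (component 𝒜 i (a - b)) c) = 0 := by
      rw [← h.component_trace_rightOp c.2, map_sub, AddMonoidHom.sub_apply, map_sub, hab,
        sub_self, map_zero]
    rw [rightOp_of_mem 𝒜 (component_mem 𝒜 i _) c.2, map_zsmul_unit] at hzero
    rw [← neg_one_uzpow_smul_self (i.2 * k.2) (tr _), hzero, smul_zero]

theorem exists_mem_eq_trace_comp_rightOp {d : Λ × ZMod 2} {φ : A →+ B}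
    (hφ : φ ∈ GSMod.homDeg (GSMod.ofHom (j.comp β))
      (GSMod.shift lam p (GSMod.ofHom (GradedRingHom.id ℬ))) d) :
    ∃ a ∈ 𝒜 d, φ = tr.comp (rightOp 𝒜 a) := by
  obtain ⟨a, rfl⟩ := h.exists_eq φ (le_iSup (GSMod.homDeg _ _) d hφ)
  refine ⟨component 𝒜 d a, component_mem 𝒜 d a, AddMonoidHom.ext fun c => ?_⟩
  induction c using Decomposition.inductionOn 𝒜 with
  | zero => simp only [map_zero]
  | add c c' hc hc' => simp only [map_add, hc, hc']
  | @homogeneous k c =>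
    rw [AddMonoidHom.comp_apply, AddMonoidHom.comp_apply, ← h.component_trace_rightOp c.2]
    exact (component_of_mem ℬ ((mem_homDeg_shift_iff.1 hφ).1 k c c.2)).symm

theorem exists_mem_trace_mul_eq {d : Λ × ZMod 2} {φ : A →+ B}
    (hmem : ∀ i, ∀ c ∈ 𝒜 i, φ c ∈ ℬ (d + i - (lam, p)))
    (hmul : ∀ b c, φ (j (β b) * c) = signHom ℬ p b * φ c) :
    ∃ a ∈ 𝒜 d, ∀ c, tr (c * a) = φ c := by
  obtain ⟨a, ha, hφ⟩ := h.exists_mem_eq_trace_comp_rightOp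
    (φ := φ.comp (signHom 𝒜 d.2).toAddMonoidHom) (mem_homDeg_shift_iff.2
      ⟨fun i c hc => hmem i _ (signHom_mem _ hc), fun b c => by
        change φ (signHom 𝒜 d.2 (j (β b) * c)) = _ * φ (signHom 𝒜 d.2 c)
        rw [map_mul, ← map_signHom, ← map_signHom, hmul, signHom_signHom]⟩)
  refine ⟨a, ha, fun c => ?_⟩
  have hc : φ (signHom 𝒜 d.2 (signHom 𝒜 d.2 c)) = tr (rightOp 𝒜 a (signHom 𝒜 d.2 c)) :=
    DFunLike.congr_fun hφ (signHom 𝒜 d.2 c)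
  rwa [rightOp_of_mem_left ha, signHom_signHom_self, eq_comm] at hc

theorem exists_homogeneous_dualBasis_ofHom :
    ∃ (n : ℕ) (d : Fin n → Λ × ZMod 2) (x : Fin n → A) (f : Fin n → A →+ B),
      (∀ s, x s ∈ 𝒜 (d s)) ∧ (∀ s i, ∀ a ∈ 𝒜 i, f s a ∈ ℬ (i - d s)) ∧
        (∀ s b a, f s (j b * a) = b * f s a) ∧ ∀ a, ∑ s, j (f s a) * x s = a := by
  have := h.finite
  have := h.projective
  obtain ⟨n, d, x, f, hx, hf, hsum⟩ := exists_homogeneous_dualBasis ℬ (GSMod.ofHom j).grading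
  exact ⟨n, d, x, fun s => (f s).toAddMonoidHom, hx, hf, fun s => (f s).map_smul, hsum⟩

theorem exists_mem_apply_trace_mul_eq {d : Λ × ZMod 2} {φ : A →+ B}
    (hmem : ∀ i, ∀ a ∈ 𝒜 i, φ a ∈ ℬ (i - d)) (hmul : ∀ b a, φ (j b * a) = b * φ a) :
    ∃ y ∈ 𝒜 ((lam, p) - d), ∀ a, β (signHom ℬ p (tr (a * α y))) = φ a := by
  let β' := RingEquiv.ofBijective β h.bijective_right
  have hβ (b : B) : β (β'.symm b) = b := β'.apply_symm_apply b
  have hβ' (b : B) : β'.symm (β b) = b := β'.symm_apply_apply b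
  obtain ⟨c, hc, htr⟩ := h.exists_mem_trace_mul_eq (d := (lam, p) - d)
    (φ := ((signHom ℬ p).comp β'.symm.toRingHom).toAddMonoidHom.comp φ)
    (fun i a ha => signHom_mem p <|
      mem_of_map_mem_of_injective (f := β) h.bijective_right.1 <| (hβ (φ a)).symm ▸ by
        rw [add_comm, add_sub_assoc, sub_sub_cancel_left, ← sub_eq_add_neg]
        exact hmem i a ha)
    (fun b a => by
      change signHom ℬ p (β'.symm (φ (j (β b) * a))) = _ * signHom ℬ p (β'.symm (φ a))
      rw [hmul, map_mul, map_mul, hβ'])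
  obtain ⟨y, rfl⟩ := h.bijective_left.2 c
  refine ⟨y, mem_of_map_mem_of_injective h.bijective_left.1 hc, fun a => ?_⟩
  rw [htr]
  exact (congrArg β (signHom_signHom_self p _)).trans (hβ (φ a))

theorem sum_mul_trace_eq {n : ℕ} {x y : Fin n → A}
    (hxy : ∀ a, ∑ s, j (β (signHom ℬ p (tr (a * α (y s))))) * x s = a) (a : A) :
    ∑ s, y s * j (tr (x s * α a)) = a := by
  refine h.bijective_left.1 (h.eq_of_trace_mul_eq fun c => ?_)
  calc tr (c * α (∑ s, y s * j (tr (x s * α a))))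
      = ∑ s, tr (c * α (y s)) * tr (x s * α a) := by
        simp only [map_sum, map_mul, Finset.mul_sum, ← mul_assoc, h.map_right]
    _ = ∑ s, tr (j (β (signHom ℬ p (tr (c * α (y s))))) * x s * α a) := by
        simp only [mul_assoc, h.trace_left_mul, signHom_signHom_self]
    _ = tr (c * α a) := by rw [← map_sum, ← Finset.sum_mul, hxy]

theorem exists_isTwistedDualGenerators :
    ∃ (n : ℕ) (d : Fin n → Λ × ZMod 2) (x y : Fin n → A),
      IsTwistedDualGenerators j α β lam p tr d x y := by
  obtain ⟨n, d, x, f, hx, hf, hmul, hsum⟩ := h.exists_homogeneous_dualBasis_ofHom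
  choose y hy htr using fun s => h.exists_mem_apply_trace_mul_eq (hf s) (hmul s)
  have hleft (a : A) : ∑ s, j (β (signHom ℬ p (tr (a * α (y s))))) * x s = a := by
    simpa only [htr] using hsum a
  exact ⟨n, d, x, y, hx, hy, hleft, h.sum_mul_trace_eq hleft⟩

theorem eq_of_forall_trace_mul_eq {c d : A} (hcd : ∀ a, tr (c * a) = tr (d * a)) : c = d := by
  obtain ⟨n, _, x, y, hxy⟩ := h.exists_isTwistedDualGenerators
  rw [← hxy.sum_left c, ← hxy.sum_left d]
  simp only [hcd]

theorem exists_forall_trace_mul_eq {φ : A →+ B} (hφ : ∀ a b, φ (a * α (j b)) = φ a * b) :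
    ∃ c, ∀ a, tr (c * a) = φ a := by
  obtain ⟨n, _, x, y, hxy⟩ := h.exists_isTwistedDualGenerators
  refine ⟨∑ s, j (β (signHom ℬ p (φ (α (y s))))) * x s, fun a => ?_⟩
  obtain ⟨a, rfl⟩ := h.bijective_left.2 a
  calc tr ((∑ s, j (β (signHom ℬ p (φ (α (y s))))) * x s) * α a)
      = ∑ s, φ (α (y s)) * tr (x s * α a) := by
        simp only [Finset.sum_mul, map_sum, mul_assoc, h.trace_left_mul, signHom_signHom_self]
    _ = φ (α (∑ s, y s * j (tr (x s * α a)))) := by simp only [map_sum, map_mul, hφ]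
    _ = φ (α a) := by rw [hxy.sum_right]

theorem mem_of_forall_trace_mul_mem {k : Λ × ZMod 2} {c : A}
    (hc : ∀ i, ∀ a ∈ 𝒜 i, tr (c * a) ∈ ℬ (k + i - (lam, p))) : c ∈ 𝒜 k := by
  obtain ⟨n, d, x, y, hxy⟩ := h.exists_isTwistedDualGenerators
  rw [← hxy.sum_left c]
  refine sum_mem fun s _ => ?_
  have htr : tr (c * α (y s)) ∈ ℬ (k - d s) := by
    convert hc _ _ (GradedFunLike.map_mem α (hxy.mem_right s)) using 2
    abel
  convert SetLike.mul_mem_graded (GradedFunLike.map_mem j (GradedFunLike.map_mem β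
    (signHom_mem p htr))) (hxy.mem_left s) using 2
  exact (sub_add_cancel k (d s)).symm

end IsTwistedFrobeniusWith
end Frobenius

/-! ### Nakayama automorphisms -/

section Nakayama

variable {A : Type u₁} [Ring A] {𝒜 : Λ × ZMod 2 → AddSubgroup A} [GradedRing 𝒜]
  {R : Type u} [Ring R] {ℛ : Λ × ZMod 2 → AddSubgroup R} [GradedRing ℛ]
  {j : ℛ →+*ᵍ 𝒜} {lam : Λ} {p : ZMod 2} {tr : A →+ R}

theorem IsTwistedDualGenerators.isDualGenerators {n : ℕ} {d : Fin n → Λ × ZMod 2}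
    {x y : Fin n → A} (h : IsFrobeniusWith j lam p tr)
    (hxy : IsTwistedDualGenerators j (GradedRingHom.id 𝒜) (GradedRingHom.id ℛ) lam p tr d x y) :
    IsDualGenerators j lam p tr d x y where
  mem_left := hxy.mem_left
  mem_right := hxy.mem_right
  left_expansion i a ha := by
    conv_lhs => rw [← hxy.sum_left a]
    rw [Finset.smul_sum]
    refine Finset.sum_congr rfl fun s _ => ?_
    have htr : tr (a * y s) ∈ ℛ (i - d s) := by
      convert h.map_mem _ _ (SetLike.mul_mem_graded ha (hxy.mem_right s)) using 2
      abel
    rw [neg_one_uzpow_smul_smul, ← mul_add, ← CharTwo.sub_eq_add, ← Prod.snd_sub,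
      ← smul_mul_assoc, ← map_zsmul_unit, ← signHom_of_mem ℛ p htr]
    rfl
  right_expansion a := (hxy.sum_right a).symm

theorem isNakayama_iff {ψ : 𝒜 →+*ᵍ 𝒜} : IsNakayama tr ψ ↔
    Function.Bijective ψ ∧ ∀ c a, tr (rightOp 𝒜 (ψ c) a) = tr (c * a) := by
  have key {i k : Λ × ZMod 2} {a c : A} (ha : a ∈ 𝒜 i) (hc : c ∈ 𝒜 k) :
      tr (rightOp 𝒜 (ψ c) a) = ((-1 : ℤˣ) ^ (i.2 * k.2)) • tr (a * ψ c) := by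
    rw [rightOp_of_mem 𝒜 (GradedFunLike.map_mem ψ hc) ha, map_zsmul_unit, mul_comm]
  refine ⟨fun hψ => ⟨hψ.bijective, fun c a => ?_⟩, fun hψ =>
    ⟨hψ.1, fun i k a c ha hc => (hψ.2 c a).symm.trans (key ha hc)⟩⟩
  induction c using Decomposition.inductionOn 𝒜 with
  | zero => simp
  | add c d hc hd => simp only [map_add, AddMonoidHom.add_apply, add_mul, hc, hd]
  | homogeneous c =>
    induction a using Decomposition.inductionOn 𝒜 with
    | zero => simp
    | add a b ha hb => simp only [map_add, mul_add, ha, hb]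
    | homogeneous a => rw [key a.2 c.2, hψ.trace_mul _ _ _ _ a.2 c.2]

namespace IsTwistedFrobeniusWith

variable (h : IsFrobeniusWith j lam p tr) (hj : superCentralizer j = ⊤)
include h hj

theorem exists_mem_trace_rightOp_eq {k : Λ × ZMod 2} {c : A} (hc : c ∈ 𝒜 k) :
    ∃ a ∈ 𝒜 k, ∀ m, tr (rightOp 𝒜 a m) = tr (c * m) := by
  obtain ⟨a, ha, hφ⟩ := h.exists_mem_eq_trace_comp_rightOp
    (φ := tr.comp (AddMonoidHom.mulLeft c)) (mem_homDeg_shift_iff.2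
      ⟨fun i m hm => h.map_mem _ _ (SetLike.mul_mem_graded hc hm), fun r m => by
        change tr (c * (j r * m)) = _ * tr (c * m)
        rw [← mul_assoc, map_mul_eq hj hc, mul_assoc, ← signHom_signHom, ← h.trace_left_mul]
        rfl⟩)
  exact ⟨a, ha, fun m => (DFunLike.congr_fun hφ m).symm⟩

theorem exists_trace_rightOp_eq (c : A) : ∃ a, ∀ m, tr (rightOp 𝒜 a m) = tr (c * m) := by
  induction c using Decomposition.inductionOn 𝒜 with
  | zero => exact ⟨0, by simp⟩
  | add c d hc hd =>
    obtain ⟨a, ha⟩ := hc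
    obtain ⟨b, hb⟩ := hd
    exact ⟨a + b, fun m => by simp only [map_add, AddMonoidHom.add_apply, add_mul, ha, hb]⟩
  | homogeneous c =>
    obtain ⟨a, -, ha⟩ := h.exists_mem_trace_rightOp_eq hj c.2
    exact ⟨a, ha⟩

theorem exists_trace_mul_eq_trace_rightOp (a : A) :
    ∃ c, ∀ m, tr (c * m) = tr (rightOp 𝒜 a m) :=
  h.exists_forall_trace_mul_eq (φ := tr.comp (rightOp 𝒜 a)) fun m r => by
    change tr (rightOp 𝒜 a (m * j r)) = tr (rightOp 𝒜 a m) * r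
    rw [rightOp_mul_map hj]
    exact h.map_right _ r

/-- The Nakayama automorphism of `h`, as an additive map: it sends `c` to the unique element `a`
with `tr ∘ ʳa = tr (c * ·)`. -/
def nakayamaHom : A →+ A :=
  AddMonoidHom.mk' (fun c => (h.exists_trace_rightOp_eq hj c).choose) fun c d =>
    h.eq_of_trace_rightOp_eq fun m => by
      rw [(h.exists_trace_rightOp_eq hj (c + d)).choose_spec, map_add, AddMonoidHom.add_apply,
        map_add, (h.exists_trace_rightOp_eq hj c).choose_spec,
        (h.exists_trace_rightOp_eq hj d).choose_spec, add_mul, map_add]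

theorem trace_rightOp_nakayamaHom (c a : A) :
    tr (rightOp 𝒜 (h.nakayamaHom hj c) a) = tr (c * a) :=
  (h.exists_trace_rightOp_eq hj c).choose_spec a

theorem nakayamaHom_mem {k : Λ × ZMod 2} {c : A} (hc : c ∈ 𝒜 k) : h.nakayamaHom hj c ∈ 𝒜 k := by
  obtain ⟨a, ha, htr⟩ := h.exists_mem_trace_rightOp_eq hj hc
  rwa [h.eq_of_trace_rightOp_eq fun m => (h.trace_rightOp_nakayamaHom hj c m).trans (htr m).symm]

theorem nakayamaHom_mul (c d : A) :
    h.nakayamaHom hj (c * d) = h.nakayamaHom hj c * h.nakayamaHom hj d := by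
  induction c using Decomposition.inductionOn 𝒜 with
  | zero => simp
  | add c c' hc hc' => simp only [add_mul, map_add, hc, hc']
  | homogeneous c =>
    induction d using Decomposition.inductionOn 𝒜 with
    | zero => simp
    | add d d' hd hd' => simp only [mul_add, map_add, hd, hd']
    | homogeneous d =>
      refine h.eq_of_trace_rightOp_eq fun a => ?_
      rw [rightOp_mul (h.nakayamaHom_mem hj c.2) (h.nakayamaHom_mem hj d.2), map_zsmul_unit,
        trace_rightOp_nakayamaHom, trace_rightOp_nakayamaHom, ← map_zsmul_unit,
        ← rightOp_mul_right (h.nakayamaHom_mem hj c.2) d.2, trace_rightOp_nakayamaHom, mul_assoc]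

theorem nakayamaHom_one : h.nakayamaHom hj 1 = 1 :=
  h.eq_of_trace_rightOp_eq fun a => by
    rw [trace_rightOp_nakayamaHom, ← map_one j, map_rightOp_eq hj]

theorem nakayamaHom_bijective : Function.Bijective (h.nakayamaHom hj) := by
  refine ⟨fun c d hcd => h.eq_of_forall_trace_mul_eq fun a => ?_, fun a => ?_⟩
  · rw [← h.trace_rightOp_nakayamaHom hj, hcd, trace_rightOp_nakayamaHom]
  · obtain ⟨c, hc⟩ := h.exists_trace_mul_eq_trace_rightOp hj a
    exact ⟨c, h.eq_of_trace_rightOp_eq fun m => (h.trace_rightOp_nakayamaHom hj c m).trans (hc m)⟩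

theorem existsUnique_isNakayama : ∃! ψ : 𝒜 →+*ᵍ 𝒜, IsNakayama tr ψ := by
  let ψ : 𝒜 →+*ᵍ 𝒜 :=
    { h.nakayamaHom hj with
      map_one' := h.nakayamaHom_one hj
      map_mul' := h.nakayamaHom_mul hj
      map_mem := h.nakayamaHom_mem hj }
  refine ⟨ψ, isNakayama_iff.2 ⟨h.nakayamaHom_bijective hj, h.trace_rightOp_nakayamaHom hj⟩,
    fun ψ' hψ' => GradedRingHom.ext fun c => h.eq_of_trace_rightOp_eq fun a => ?_⟩
  exact ((isNakayama_iff.1 hψ').2 c a).trans (h.trace_rightOp_nakayamaHom hj c a).symm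

theorem nakayama_map {ψ : 𝒜 →+*ᵍ 𝒜} (hψ : IsNakayama tr ψ) (r : R) : ψ (j r) = j r :=
  h.eq_of_trace_rightOp_eq fun a => by
    rw [(isNakayama_iff.1 hψ).2, map_rightOp_eq hj]

end IsTwistedFrobeniusWith
end Nakayama

/-! ### The relative trace -/

section RelativeTrace

variable {A : Type u₁} [Ring A] {𝒜 : Λ × ZMod 2 → AddSubgroup A} [GradedRing 𝒜]
  {B : Type u₂} [Ring B] {ℬ : Λ × ZMod 2 → AddSubgroup B} [GradedRing ℬ]
  {R : Type u} [Ring R] {ℛ : Λ × ZMod 2 → AddSubgroup R} [GradedRing ℛ]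
  {i : ℛ →+*ᵍ ℬ} {j : ℬ →+*ᵍ 𝒜} {lamA lamB : Λ} {pA pB : ZMod 2} {trA : A →+ R} {trB : B →+ R}
  {ψA : 𝒜 →+*ᵍ 𝒜} {ψB : ℬ →+*ᵍ ℬ} {tr : A →+ B}

omit [DecidableEq Λ] in
theorem degree_sub_add_degree (lamA lamB : Λ) (pA pB : ZMod 2) :
    (lamA - lamB, pA + pB) + (lamB, pB) = (lamA, pA) :=
  Prod.ext (sub_add_cancel _ _) (CharTwo.add_cancel_right _ _)

/-- `tr : A → B` is the trace map relative to the trace maps `trA` and `trB` of two extensions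
`A` and `B` of the same ring, where `ψ` is the Nakayama automorphism of `A`: it is the adjoint of
`j : B → A` for the pairings `(a, c) ↦ trA (a * ψ c)` of `A` and `(b, c) ↦ trB (b * c)` of `B`. -/
def IsRelativeTrace (j : ℬ →+*ᵍ 𝒜) (trA : A →+ R) (trB : B →+ R) (ψ : 𝒜 →+*ᵍ 𝒜)
    (tr : A →+ B) : Prop :=
  ∀ a b, trB (tr a * b) = trA (a * ψ (j b))

omit [GradedRing ℬ] [GradedRing ℛ] in
theorem finite_ofHom_of_comp (h : Module.Finite R (GSMod.ofHom (j.comp i)).carrier) :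
    Module.Finite B (GSMod.ofHom j).carrier := by
  let _ : Module R A := Module.compHom A (j.comp i).toRingHom
  let _ : Module B A := Module.compHom A j.toRingHom
  let _ : Module R B := Module.compHom B i.toRingHom
  have : IsScalarTower R B A := ⟨fun r b a => by
    change j (i r * b) * a = j (i r) * (j b * a)
    rw [map_mul, mul_assoc]⟩
  have : Module.Finite R A := h
  exact Module.Finite.of_restrictScalars_finite R B A

theorem exists_isRelativeTrace (hA : IsFrobeniusWith (j.comp i) lamA pA trA)
    (hB : IsFrobeniusWith i lamB pB trB) (hψ : ∀ r, ψA (j (i r)) = j (i r)) :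
    ∃ tr, IsRelativeTrace j trA trB ψA tr := by
  have hex (a : A) : ∃ c, ∀ b, trB (c * b) = trA (a * ψA (j b)) :=
    hB.exists_forall_trace_mul_eq
      (φ := trA.comp ((AddMonoidHom.mulLeft a).comp (ψA.comp j).toRingHom.toAddMonoidHom))
      fun b r => by
        change trA (a * ψA (j (b * i r))) = trA (a * ψA (j b)) * r
        rw [map_mul j, map_mul ψA, hψ, ← mul_assoc]
        exact hA.map_right _ r
  choose tr htr using hex
  refine ⟨AddMonoidHom.mk' tr fun a a' => hB.eq_of_forall_trace_mul_eq fun b => ?_, htr⟩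
  rw [htr, add_mul, add_mul, map_add, map_add, htr, htr]

namespace IsRelativeTrace

section

variable (h : IsRelativeTrace j trA trB ψA tr)
include h

omit [AddCommGroup Λ] [DecidableEq Λ] [GradedRing 𝒜] [GradedRing ℬ] in
theorem trace_trace (a : A) : trB (tr a) = trA a := by
  simpa only [map_one, mul_one] using h a 1

omit [GradedRing 𝒜] in
theorem map_right (hB : IsFrobeniusWith i lamB pB trB) (a : A) (b : B) :
    tr (a * ψA (j b)) = tr a * b :=
  hB.eq_of_forall_trace_mul_eq fun b' => by
    rw [h, mul_assoc, mul_assoc, h, map_mul j, map_mul ψA]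

theorem map_mem (hA : IsFrobeniusWith (j.comp i) lamA pA trA)
    (hB : IsFrobeniusWith i lamB pB trB) {k : Λ × ZMod 2} {a : A} (ha : a ∈ 𝒜 k) :
    tr a ∈ ℬ (k - (lamA - lamB, pA + pB)) :=
  hB.mem_of_forall_trace_mul_mem fun l b hb => by
    rw [h]
    convert hA.map_mem _ _ (SetLike.mul_mem_graded ha
      (GradedFunLike.map_mem ψA (GradedFunLike.map_mem j hb))) using 2
    rw [← degree_sub_add_degree lamA lamB pA pB]
    abel

theorem map_left (hA : IsFrobeniusWith (j.comp i) lamA pA trA)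
    (hB : IsFrobeniusWith i lamB pB trB) (hψA : IsNakayama trA ψA) (hψB : IsNakayama trB ψB)
    (b : B) (a : A) : tr (j (ψB b) * a) = signHom ℬ (pA + pB) b * tr a := by
  induction b using Decomposition.inductionOn ℬ with
  | zero => simp
  | add b c hb hc => simp only [map_add, add_mul, hb, hc]
  | @homogeneous l b =>
    refine hB.eq_of_forall_trace_mul_eq fun b' => ?_
    have hb : ψB b ∈ ℬ l := GradedFunLike.map_mem ψB b.2
    have hjb : ψA (j (ψB b)) ∈ 𝒜 l := GradedFunLike.map_mem ψA (GradedFunLike.map_mem j hb)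
    calc trB (tr (j (ψB b) * a) * b') = trA (j (ψB b) * (a * ψA (j b'))) := by rw [h, mul_assoc]
      _ = trA (signHom 𝒜 l.2 a * ψA (j (signHom ℬ l.2 b' * ψB b))) := by
        rw [← (isNakayama_iff.1 hψA).2, rightOp_of_mem_left hjb]
        simp only [map_mul j, map_mul ψA, map_mul (signHom 𝒜 _), map_signHom, mul_assoc]
      _ = trB (tr (signHom 𝒜 l.2 a) * (signHom ℬ l.2 b' * ψB b)) := (h _ _).symm
      _ = ((-1 : ℤˣ) ^ ((pA + pB) * l.2)) • trB (signHom ℬ l.2 (tr a * b') * ψB b) := by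
        rw [map_mul (signHom ℬ _), signHom_map_of_degree (fun _ _ => h.map_mem hA hB),
          mul_comm (pA + pB), smul_mul_assoc, smul_mul_assoc, map_zsmul_unit,
          neg_one_uzpow_smul_self, mul_assoc]
      _ = trB (signHom ℬ (pA + pB) b * tr a * b') := by
        rw [← rightOp_of_mem_left hb, (isNakayama_iff.1 hψB).2, ← map_zsmul_unit,
          signHom_of_mem ℬ _ b.2, smul_mul_assoc, smul_mul_assoc, mul_assoc]

theorem map_rightOp_left (hA : IsFrobeniusWith (j.comp i) lamA pA trA)
    (hB : IsFrobeniusWith i lamB pB trB) (hψA : IsNakayama trA ψA) (hψB : IsNakayama trB ψB)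
    {d : Λ × ZMod 2} {a : A} (ha : a ∈ 𝒜 d) (b : B) (c : A) :
    tr (rightOp 𝒜 a (j (ψB b) * c)) = signHom ℬ (pA + pB + d.2) b * tr (rightOp 𝒜 a c) := by
  rw [rightOp_of_mem_left ha, rightOp_of_mem_left ha, map_mul (signHom 𝒜 _), ← map_signHom,
    ← map_signHom, mul_assoc, h.map_left hA hB hψA hψB, signHom_signHom]

theorem exists_eq_comp_rightOp (hA : IsFrobeniusWith (j.comp i) lamA pA trA)
    (hB : IsFrobeniusWith i lamB pB trB) (hψA : IsNakayama trA ψA) (hψB : IsNakayama trB ψB)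
    (hψB_map : ∀ r, ψB (i r) = i r) {d : Λ × ZMod 2} {φ : A →+ B}
    (hφ : φ ∈ GSMod.homDeg (GSMod.ofHom (j.comp ψB))
      (GSMod.shift (lamA - lamB) (pA + pB) (GSMod.ofHom (GradedRingHom.id ℬ))) d) :
    ∃ a, φ = tr.comp (rightOp 𝒜 a) := by
  obtain ⟨hmem, hmul⟩ := mem_homDeg_shift_iff.1 hφ
  have hmul (b : B) (c : A) : φ (j (ψB b) * c) = signHom ℬ (pA + pB + d.2) b * φ c := hmul b c
  have hmem_trace (k : Λ × ZMod 2) (c : A) (hc : c ∈ 𝒜 k) :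
      trB (φ c) ∈ ℛ (d + k - (lamA, pA)) := by
    rw [← degree_sub_add_degree lamA lamB, ← sub_sub]
    exact hB.map_mem _ _ (hmem k c hc)
  have hmul_trace (r : R) (c : A) :
      trB (φ (j (i r) * c)) = signHom ℛ (pA + d.2) r * trB (φ c) := by
    have hleft (b : B) : trB (i (signHom ℛ (pA + pB + d.2) r) * b) =
        signHom ℛ pB (signHom ℛ (pA + pB + d.2) r) * trB b := hB.trace_left_mul _ b
    rw [← hψB_map, hmul, ← map_signHom, hleft, signHom_signHom, ← add_assoc,
      ← add_assoc, add_comm pB, CharTwo.add_cancel_right]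
  obtain ⟨a, ha, hφa⟩ := hA.exists_mem_eq_trace_comp_rightOp (φ := trB.comp φ)
    (mem_homDeg_shift_iff.2 ⟨hmem_trace, hmul_trace⟩)
  have htr (c : A) : trB (φ c) = trB (tr (rightOp 𝒜 a c)) :=
    (DFunLike.congr_fun hφa c).trans (h.trace_trace _).symm
  refine ⟨a, AddMonoidHom.ext fun c => hB.eq_of_trace_mul_eq fun b => ?_⟩
  rw [← signHom_signHom_self (𝒜 := ℬ) (pA + pB + d.2) b, AddMonoidHom.comp_apply, ← hmul,
    ← h.map_rightOp_left hA hB hψA hψB ha, htr]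

theorem isTwistedFrobeniusWith (hj : Function.Injective j)
    (hA : IsFrobeniusWith (j.comp i) lamA pA trA) (hB : IsFrobeniusWith i lamB pB trB)
    (hproj : Module.Projective B (GSMod.ofHom j).carrier) (hψA : IsNakayama trA ψA)
    (hψB : IsNakayama trB ψB) (hψB_map : ∀ r, ψB (i r) = i r) :
    IsTwistedFrobeniusWith j ψA ψB (lamA - lamB) (pA + pB) tr where
  injective := hj
  bijective_left := hψA.bijective
  bijective_right := hψB.bijective
  finite := finite_ofHom_of_comp hA.finite
  projective := hproj
  map_mem _ _ ha := h.map_mem hA hB ha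
  map_left k b a hb := by rw [h.map_left hA hB hψA hψB, signHom_of_mem ℬ _ hb, smul_mul_assoc]
  map_right := h.map_right hB
  eq_zero a ha := hA.eq_zero a fun c => by rw [← h.trace_trace, ha, map_zero]
  exists_eq φ hφ := by
    have hle : GSMod.HOM (GSMod.ofHom (j.comp ψB)) (GSMod.shift (lamA - lamB) (pA + pB)
        (GSMod.ofHom (GradedRingHom.id ℬ))) ≤
          ((AddMonoidHom.compHom tr).comp (rightOp 𝒜)).range := iSup_le fun d φ hφ => by
      obtain ⟨a, rfl⟩ := h.exists_eq_comp_rightOp hA hB hψA hψB hψB_map hφ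
      exact ⟨a, rfl⟩
    obtain ⟨a, ha⟩ := hle hφ
    exact ⟨a, ha.symm⟩

theorem eq_sum_of_isDualGenerators (hA : IsFrobeniusWith (j.comp i) lamA pA trA)
    (hB : IsFrobeniusWith i lamB pB trB) (hψA : IsNakayama trA ψA) {n : ℕ}
    {d : Fin n → Λ × ZMod 2} {x y : Fin n → B} (hxy : IsDualGenerators i lamB pB trB d x y)
    {k : Λ × ZMod 2} {a : A} (ha : a ∈ 𝒜 k) :
    tr a = ((-1 : ℤˣ) ^ (pB * (pA + k.2))) •
      ∑ s, ((-1 : ℤˣ) ^ ((pB - (d s).2) * (pB + k.2))) • (i (trA (j (y s) * a)) * x s) := by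
  have htr (s : Fin n) : trB (tr a * y s) =
      ((-1 : ℤˣ) ^ (k.2 * (pB - (d s).2))) • trA (j (y s) * a) := by
    rw [h, hψA.trace_mul _ _ _ _ ha (GradedFunLike.map_mem j (hxy.mem_right s))]
    exact (neg_one_uzpow_smul_self _ _).symm
  have hsign (k l p q : ZMod 2) :
      p * (k - (q + p)) + p * l + k * (p - l) = p * (q + k) + (p - l) * (p + k) := by
    revert k l p q
    decide
  rw [hxy.left_expansion _ _ (h.map_mem hA hB ha), Finset.smul_sum, Finset.smul_sum]
  refine Finset.sum_congr rfl fun s _ => ?_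
  rw [htr, map_zsmul_unit, smul_mul_assoc, neg_one_uzpow_smul_smul, neg_one_uzpow_smul_smul,
    neg_one_uzpow_smul_smul, Prod.snd_sub, hsign]

end
end IsRelativeTrace
end RelativeTrace

/-! ### The adjunction -/

namespace GSBimod

variable {A₁ : Type u₁} [Ring A₁] {𝒜₁ : Λ × ZMod 2 → AddSubgroup A₁}
  {A₂ : Type u₂} [Ring A₂] {𝒜₂ : Λ × ZMod 2 → AddSubgroup A₂}
  (P : GSBimod.{t, u₁, u₂, v} 𝒜₁ 𝒜₂) (M : GSMod.{t, u₂, w} 𝒜₂)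

/-- The balanced biadditive map `(x, m) ↦ x ⊗ m` into `P ⊗_{A₂} M`. -/
def tmulHom : P.carrier →+ M.carrier →+ P.TensorCarrier M :=
  AddMonoidHom.mk' (fun x => AddMonoidHom.mk' (P.tmul M x) (P.tmul_add M x)) fun x y =>
    AddMonoidHom.ext (P.add_tmul M x y)

variable {P M} {X : Type*} [AddCommGroup X]

theorem addMonoidHom_ext {f g : P.TensorCarrier M →+ X}
    (hfg : ∀ x m, f (P.tmulHom M x m) = g (P.tmulHom M x m)) : f = g :=
  AddMonoidHom.ext <| P.tensor_induction (p := fun z => f z = g z)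
    ((map_zero f).trans (map_zero g).symm)
    (fun y z hy hz => (map_add f y z).trans ((congrArg₂ _ hy hz).trans (map_add g y z).symm)) hfg

theorem map_mem_of_mem_tensorGrading {f : P.TensorCarrier M →+ X} {S : AddSubgroup X}
    {d : Λ × ZMod 2} (hf : ∀ i k, i + k = d → ∀ x ∈ P.grading i, ∀ m ∈ M.grading k,
      f (P.tmulHom M x m) ∈ S) {z : P.TensorCarrier M} (hz : z ∈ P.tensorGrading M d) :
    f z ∈ S := by
  have hle : P.tensorGrading M d ≤ S.comap f := (AddSubgroup.closure_le _).2 <| by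
    rintro _ ⟨i, k, x, m, hd, hx, hm, rfl⟩
    exact hf i k hd x hx m hm
  exact hle hz

end GSBimod

section Adjunction

variable {A : Type u₁} [Ring A] {𝒜 : Λ × ZMod 2 → AddSubgroup A} [GradedRing 𝒜]
  {B : Type u₂} [Ring B] {ℬ : Λ × ZMod 2 → AddSubgroup B} [GradedRing ℬ]

section Restrict

variable (j : ℬ →+*ᵍ 𝒜) (α : 𝒜 →+*ᵍ 𝒜) (β : ℬ →+*ᵍ ℬ) (lam : Λ) (p : ZMod 2)
  (M : GSMod.{t, u₁, w} 𝒜)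

/-- The shifted twisted restriction `{lam, p} ^β_B A^α_A ⊗_A M`. Unlike in
`shiftedTwistedRestriction`, the universe of `M` is arbitrary, so that it can be inferred. -/
def restrict : GSMod.{t, u₂, max u₁ w} ℬ :=
  GSMod.shift lam p ((GSBimod.ofHoms (j.comp β) α).tensorObj M)

/-- The biadditive map `(a, m) ↦ a ⊗ m` into the shifted twisted restriction of `M`. -/
def resTmul : A →+ M.carrier →+ (restrict j α β lam p M).carrier :=
  (GSBimod.ofHoms (j.comp β) α).tmulHom M

theorem resTmul_mul (a c : A) (m : M.carrier) :
    resTmul j α β lam p M (a * α c) m = resTmul j α β lam p M a (c • m) :=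
  GSBimod.op_smul_tmul (GSBimod.ofHoms (j.comp β) α) M a c m

theorem smul_resTmul (b : B) (a : A) (m : M.carrier) :
    b • resTmul j α β lam p M a m = resTmul j α β lam p M (j (β (signHom ℬ p b)) * a) m :=
  rfl

variable {M} in
theorem resTmul_mem {i k : Λ × ZMod 2} {a : A} {m : M.carrier} (ha : a ∈ 𝒜 i)
    (hm : m ∈ M.grading k) :
    resTmul j α β lam p M a m ∈ (restrict j α β lam p M).grading (i + k + (lam, p)) := by
  have hmem := GSBimod.tmul_mem (P := GSBimod.ofHoms (j.comp β) α) ha hm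
  rwa [← add_sub_cancel_right (i + k) (lam, p)] at hmem

variable {j α β lam p M} in
theorem restrict_hom_ext {X : Type*} [AddCommGroup X] {f g : (restrict j α β lam p M).carrier →+ X}
    (hfg : ∀ a m, f (resTmul j α β lam p M a m) = g (resTmul j α β lam p M a m)) : f = g :=
  GSBimod.addMonoidHom_ext hfg

end Restrict

section Induct

variable (j : ℬ →+*ᵍ 𝒜) (N : GSMod.{t, u₂, w} ℬ)

/-- The induced module `A ⊗_B N`, for `N` in an arbitrary universe. -/
def induct : GSMod.{t, u₁, max u₁ w} 𝒜 :=
  (GSBimod.ofHoms (GradedRingHom.id 𝒜) j).tensorObj N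

/-- The biadditive map `(a, n) ↦ a ⊗ n` into the induction of `N`. -/
def indTmul : A →+ N.carrier →+ (induct j N).carrier :=
  (GSBimod.ofHoms (GradedRingHom.id 𝒜) j).tmulHom N

theorem indTmul_mul (a : A) (b : B) (n : N.carrier) :
    indTmul j N (a * j b) n = indTmul j N a (b • n) :=
  GSBimod.op_smul_tmul (GSBimod.ofHoms (GradedRingHom.id 𝒜) j) N a b n

theorem smul_indTmul (c a : A) (n : N.carrier) :
    c • indTmul j N a n = indTmul j N (c * a) n :=
  rfl

variable {N} in
theorem indTmul_mem {i k : Λ × ZMod 2} {a : A} {n : N.carrier} (ha : a ∈ 𝒜 i)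
    (hn : n ∈ N.grading k) : indTmul j N a n ∈ (induct j N).grading (i + k) :=
  GSBimod.tmul_mem (P := GSBimod.ofHoms (GradedRingHom.id 𝒜) j) ha hn

variable {j N} in
theorem induct_hom_ext {X : Type*} [AddCommGroup X] {f g : (induct j N).carrier →+ X}
    (hfg : ∀ a n, f (indTmul j N a n) = g (indTmul j N a n)) : f = g :=
  GSBimod.addMonoidHom_ext hfg

end Induct

variable {j : ℬ →+*ᵍ 𝒜} {α : 𝒜 →+*ᵍ 𝒜} {β : ℬ →+*ᵍ ℬ} {lam : Λ} {p : ZMod 2} {tr : A →+ B}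

omit [DecidableEq Λ] in
theorem neg_prod_zmod_two (lam : Λ) (p : ZMod 2) : (-lam, p) = -(lam, p) :=
  Prod.ext rfl (CharTwo.neg_eq p).symm

namespace IsTwistedFrobeniusWith

section Counit

variable (h : IsTwistedFrobeniusWith j α β lam p tr) (N : GSMod.{t, u₂, w} ℬ)

/-- The biadditive map `(a, a' ⊗ n) ↦ tr (a α(a')) n`. -/
def traceAction : A →+ (induct j N).carrier →+ N.carrier :=
  AddMonoidHom.mk'
    (fun a => GSBimod.tensorLift (GSBimod.ofHoms (GradedRingHom.id 𝒜) j) N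
      ((smulAddHom B N.carrier).comp
        (tr.comp ((AddMonoidHom.mulLeft a).comp α.toRingHom.toAddMonoidHom)))
      fun (x : A) b n => by
        change tr (a * α (x * j b)) • n = tr (a * α x) • b • n
        rw [map_mul α, ← mul_assoc, h.map_right, mul_smul])
    fun a a' => induct_hom_ext fun c n => by
      change tr ((a + a') * α c) • n = tr (a * α c) • n + tr (a' * α c) • n
      rw [add_mul, map_add, add_smul]

theorem traceAction_indTmul (a a' : A) (n : N.carrier) :
    h.traceAction N a (indTmul j N a' n) = tr (a * α a') • n :=
  rfl

theorem traceAction_mul (a c : A) (z : (induct j N).carrier) :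
    h.traceAction N (a * α c) z = h.traceAction N a (c • z) := by
  refine DFunLike.congr_fun (f := h.traceAction N (a * α c))
    (g := (h.traceAction N a).comp (DistribSMul.toAddMonoidHom _ c))
    (induct_hom_ext fun a' n => ?_) z
  change _ = h.traceAction N a (c • indTmul j N a' n)
  rw [smul_indTmul, traceAction_indTmul, traceAction_indTmul, map_mul α, mul_assoc]

theorem traceAction_mul_left (b : B) (a : A) (z : (induct j N).carrier) :
    h.traceAction N (j (β (signHom ℬ p b)) * a) z = b • h.traceAction N a z := by
  refine DFunLike.congr_fun (f := h.traceAction N (j (β (signHom ℬ p b)) * a))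
    (g := (DistribSMul.toAddMonoidHom _ b).comp (h.traceAction N a))
    (induct_hom_ext fun a' n => ?_) z
  change _ = b • h.traceAction N a (indTmul j N a' n)
  rw [traceAction_indTmul, traceAction_indTmul, mul_assoc, h.trace_left_mul, signHom_signHom_self,
    mul_smul]

theorem traceAction_mem {i k : Λ × ZMod 2} {a : A} {z : (induct j N).carrier} (ha : a ∈ 𝒜 i)
    (hz : z ∈ (induct j N).grading k) : h.traceAction N a z ∈ N.grading (i + k - (lam, p)) := by
  refine GSBimod.map_mem_of_mem_tensorGrading (f := h.traceAction N a) ?_ hz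
  rintro l k rfl c hc n hn
  have hdeg : i + (l + k) - (lam, p) = i + l - (lam, p) + k := by abel
  rw [hdeg]
  exact N.smul_mem (h.map_mem _ _ (SetLike.mul_mem_graded ha (GradedFunLike.map_mem α hc))) hn

/-- The map `a ⊗ (a' ⊗ n) ↦ tr (a α(a')) n`. -/
def counitHom : (restrict j α β (-lam) p (induct j N)).carrier →+ N.carrier :=
  GSBimod.tensorLift (GSBimod.ofHoms (j.comp β) α) _ (h.traceAction N) (h.traceAction_mul N)

theorem counitHom_resTmul (a : A) (z : (induct j N).carrier) :
    h.counitHom N (resTmul j α β (-lam) p _ a z) = h.traceAction N a z :=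
  rfl

theorem counitHom_smul (b : B) (z : (restrict j α β (-lam) p (induct j N)).carrier) :
    h.counitHom N (b • z) = b • h.counitHom N z := by
  refine DFunLike.congr_fun (f := (h.counitHom N).comp (DistribSMul.toAddMonoidHom _ b))
    (g := (DistribSMul.toAddMonoidHom _ b).comp (h.counitHom N))
    (restrict_hom_ext fun a z => ?_) z
  change h.counitHom N (b • resTmul j α β (-lam) p _ a z) = b • h.traceAction N a z
  rw [smul_resTmul, counitHom_resTmul, traceAction_mul_left]

theorem counitHom_mem {k : Λ × ZMod 2} {z : (restrict j α β (-lam) p (induct j N)).carrier}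
    (hz : z ∈ (restrict j α β (-lam) p (induct j N)).grading k) :
    h.counitHom N z ∈ N.grading k := by
  refine GSBimod.map_mem_of_mem_tensorGrading (f := h.counitHom N) (fun i l hil a ha z hz => ?_) hz
  rw [neg_prod_zmod_two, sub_neg_eq_add] at hil
  rw [← add_sub_cancel_right k (lam, p), ← hil]
  exact h.traceAction_mem N ha hz

end Counit

/-- The counit `a ⊗ (a' ⊗ n) ↦ tr (a α(a')) n` of the adjunction. -/
def counit (h : IsTwistedFrobeniusWith j α β lam p tr) :
    inductionFunctor.{t, u₁, u₂, w} j ⋙ shiftedTwistedRestriction.{t, u₁, u₂, w} j α β (-lam) p ⟶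
      𝟭 (GSMod.{t, u₂, max u₁ w} ℬ) where
  app N := GSMod.Hom.mk { h.counitHom N with map_smul' := h.counitHom_smul N }
    fun _ _ => h.counitHom_mem N
  naturality N N' g := by
    let G := inductionFunctor.{t, u₁, u₂, w} j
    refine GSMod.Hom.ext (LinearMap.toAddMonoidHom_injective (restrict_hom_ext fun a z => ?_))
    refine DFunLike.congr_fun
      (f := (h.traceAction N' a).comp (G.map g).toLinearMap.toAddMonoidHom)
      (g := g.toLinearMap.toAddMonoidHom.comp (h.traceAction N a))
      (induct_hom_ext fun c n => ?_) z
    exact (g.toLinearMap.map_smul (tr (a * α c)) n).symm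

end IsTwistedFrobeniusWith

section Unit

variable {n : ℕ} (j α β lam p) (x y : Fin n → A) (M : GSMod.{t, u₁, w} 𝒜)

/-- The map `m ↦ ∑ s, y s ⊗ (x s ⊗ m)`. -/
def unitHom : M.carrier →+ (induct j (restrict j α β (-lam) p M)).carrier :=
  ∑ s, (indTmul j _ (y s)).comp (resTmul j α β (-lam) p M (x s))

theorem unitHom_apply (m : M.carrier) : unitHom j α β lam p x y M m =
    ∑ s, indTmul j _ (y s) (resTmul j α β (-lam) p M (x s) m) := by
  simp only [unitHom, AddMonoidHom.finsetSum_apply, AddMonoidHom.comp_apply]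

end Unit

namespace IsTwistedDualGenerators

variable {n : ℕ} {d : Fin n → Λ × ZMod 2} {x y : Fin n → A}

section

variable (hxy : IsTwistedDualGenerators j α β lam p tr d x y) (M : GSMod.{t, u₁, w} 𝒜)
include hxy

theorem unitHom_smul (a : A) (m : M.carrier) :
    unitHom j α β lam p x y M (a • m) = a • unitHom j α β lam p x y M m := by
  have hexpand (s : Fin n) :
      indTmul j (restrict j α β (-lam) p M) (y s) (resTmul j α β (-lam) p M (x s) (a • m)) =
        ∑ r, indTmul j (restrict j α β (-lam) p M) (y s * j (tr (x s * α (a * y r))))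
          (resTmul j α β (-lam) p M (x r) m) := by
    rw [← resTmul_mul, ← hxy.sum_left (x s * α a)]
    simp only [map_sum, AddMonoidHom.finsetSum_apply, indTmul_mul, smul_resTmul, map_mul α,
      mul_assoc]
  simp only [unitHom_apply, hexpand, Finset.smul_sum]
  rw [Finset.sum_comm]
  refine Finset.sum_congr rfl fun r _ => ?_
  rw [smul_indTmul, ← AddMonoidHom.finsetSum_apply, ← map_sum, hxy.sum_right]

theorem unitHom_mem {k : Λ × ZMod 2} {m : M.carrier} (hm : m ∈ M.grading k) :
    unitHom j α β lam p x y M m ∈ (induct j (restrict j α β (-lam) p M)).grading k := by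
  rw [unitHom_apply]
  refine sum_mem fun s _ => ?_
  convert indTmul_mem j (hxy.mem_right s) (resTmul_mem j α β (-lam) p (hxy.mem_left s) hm) using 1
  rw [neg_prod_zmod_two]
  congr 1
  abel

theorem traceAction_unitHom (h : IsTwistedFrobeniusWith j α β lam p tr) (a : A) (m : M.carrier) :
    h.traceAction (restrict j α β (-lam) p M) a (unitHom j α β lam p x y M m) =
      resTmul j α β (-lam) p M a m := by
  conv_rhs => rw [← hxy.sum_left a]
  simp only [unitHom_apply, map_sum, AddMonoidHom.finsetSum_apply,
    IsTwistedFrobeniusWith.traceAction_indTmul, smul_resTmul]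

theorem sum_indTmul_traceAction (h : IsTwistedFrobeniusWith j α β lam p tr)
    (N : GSMod.{t, u₂, w} ℬ) (a : A) (m : N.carrier) :
    ∑ s, indTmul j N (y s) (h.traceAction N (x s) (indTmul j N a m)) = indTmul j N a m := by
  conv_rhs => rw [← hxy.sum_right a]
  simp only [map_sum, AddMonoidHom.finsetSum_apply, IsTwistedFrobeniusWith.traceAction_indTmul,
    indTmul_mul]

end

/-- The unit `m ↦ ∑ s, y s ⊗ (x s ⊗ m)` of the adjunction. -/
def unit (hxy : IsTwistedDualGenerators j α β lam p tr d x y) :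
    𝟭 (GSMod.{t, u₁, max u₁ w} 𝒜) ⟶
      shiftedTwistedRestriction.{t, u₁, u₂, w} j α β (-lam) p ⋙
        inductionFunctor.{t, u₁, u₂, w} j where
  app M := GSMod.Hom.mk { unitHom j α β lam p x y M with map_smul' := hxy.unitHom_smul M }
    fun _ _ => hxy.unitHom_mem M
  naturality M M' g := by
    let F := shiftedTwistedRestriction.{t, u₁, u₂, w} j α β (-lam) p
    let G := inductionFunctor.{t, u₁, u₂, w} j
    refine GSMod.Hom.ext (LinearMap.ext fun m => ?_)
    change unitHom j α β lam p x y M' (g.toLinearMap m) =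
      (G.map (F.map g)).toLinearMap (unitHom j α β lam p x y M m)
    rw [unitHom_apply, unitHom_apply]
    refine Eq.trans ?_ (map_sum (G.map (F.map g)).toLinearMap _ _).symm
    rfl

/-- Twisted restriction along a twisted Frobenius extension is left adjoint to induction. -/
def adjunction (hxy : IsTwistedDualGenerators j α β lam p tr d x y)
    (h : IsTwistedFrobeniusWith j α β lam p tr) :
    shiftedTwistedRestriction.{t, u₁, u₂, w} j α β (-lam) p ⊣
      inductionFunctor.{t, u₁, u₂, w} j where
  unit := hxy.unit.{t, u₁, u₂, w}
  counit := h.counit.{t, u₁, u₂, w}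
  left_triangle_components M := by
    let F := shiftedTwistedRestriction.{t, u₁, u₂, w} j α β (-lam) p
    refine GSMod.Hom.ext (LinearMap.ext fun z => ?_)
    refine DFunLike.congr_fun (f := (h.counitHom (F.obj M)).comp
      (F.map (hxy.unit.{t, u₁, u₂, w}.app M)).toLinearMap.toAddMonoidHom)
      (g := AddMonoidHom.id _) (restrict_hom_ext fun a m => ?_) z
    exact hxy.traceAction_unitHom M h a m
  right_triangle_components N := by
    let G := inductionFunctor.{t, u₁, u₂, w} j
    refine GSMod.Hom.ext (LinearMap.ext fun z => ?_)
    refine DFunLike.congr_fun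
      (f := (G.map (h.counit.{t, u₁, u₂, w}.app N)).toLinearMap.toAddMonoidHom.comp
        (hxy.unit.{t, u₁, u₂, w}.app (G.obj N)).toLinearMap.toAddMonoidHom)
      (g := AddMonoidHom.id _) (induct_hom_ext fun a m => ?_) z
    let φ := (G.map (h.counit.{t, u₁, u₂, w}.app N)).toLinearMap
    refine (congrArg φ (unitHom_apply j α β lam p x y (induct j N) (indTmul j N a m))).trans ?_
    exact (map_sum φ _ _).trans (hxy.sum_indTmul_traceAction h N a m)

end IsTwistedDualGenerators
end Adjunction

end NestedFrobenius

end

open NestedFrobenius in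
theorem theorem3 {Λ : Type t} [AddCommGroup Λ] [DecidableEq Λ]
    {R : Type u} [Ring R] {ℛ : Λ × ZMod 2 → AddSubgroup R} [GradedRing ℛ]
    {B : Type u₂} [Ring B] {ℬ : Λ × ZMod 2 → AddSubgroup B} [GradedRing ℬ]
    {A : Type u₁} [Ring A] {𝒜 : Λ × ZMod 2 → AddSubgroup A} [GradedRing 𝒜]
    (i : ℛ →+*ᵍ ℬ) (hi : Function.Injective i) (j : ℬ →+*ᵍ 𝒜) (hj : Function.Injective j)
    (hcent : superCentralizer (j.comp i) = ⊤)
    (lamA lamB : Λ) (pA pB : ZMod 2) (trA : A →+ R) (trB : B →+ R)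
    (hA : IsFrobeniusWith (j.comp i) lamA pA trA) (hB : IsFrobeniusWith i lamB pB trB)
    (hproj : Module.Projective B (GSMod.ofHom j).carrier) :
    (∃! ψA : 𝒜 →+*ᵍ 𝒜, IsNakayama trA ψA) ∧
    (∃! ψB : ℬ →+*ᵍ ℬ, IsNakayama trB ψB) ∧
    (∃ (n : ℕ) (dx : Fin n → Λ × ZMod 2) (x y : Fin n → B),
      IsDualGenerators i lamB pB trB dx x y) ∧
    ∀ (ψA : 𝒜 →+*ᵍ 𝒜) (ψB : ℬ →+*ᵍ ℬ), IsNakayama trA ψA → IsNakayama trB ψB →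
      IsTwistedFrobenius j ψA ψB (lamA - lamB) (pA + pB) ∧
      (∀ (n : ℕ) (dx : Fin n → Λ × ZMod 2) (x y : Fin n → B),
        IsDualGenerators i lamB pB trB dx x y →
        ∃ tr : A →+ B,
          (∀ (k : Λ × ZMod 2) (a : A), a ∈ 𝒜 k →
            tr a = ((-1 : ℤˣ) ^ (pB * (pA + k.2))) •
              ∑ s, ((-1 : ℤˣ) ^ ((pB - (dx s).2) * (pB + k.2))) •
                (i (trA (j (y s) * a)) * x s)) ∧
          IsTwistedFrobeniusWith j ψA ψB (lamA - lamB) (pA + pB) tr) ∧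
      Nonempty (shiftedTwistedRestriction.{t, u₁, u₂, w} j ψA ψB (lamB - lamA) (pA + pB) ⊣
        inductionFunctor.{t, u₁, u₂, w} j) := by
  have hi_cent : superCentralizer i = ⊤ := superCentralizer_eq_top_of_comp hj hcent
  have hdual : ∃ (n : ℕ) (dx : Fin n → Λ × ZMod 2) (x y : Fin n → B),
      IsDualGenerators i lamB pB trB dx x y := by
    obtain ⟨n, dx, x, y, hxy⟩ := hB.exists_isTwistedDualGenerators
    exact ⟨n, dx, x, y, hxy.isDualGenerators hB⟩
  refine ⟨hA.existsUnique_isNakayama hcent, hB.existsUnique_isNakayama hi_cent, hdual,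
    fun ψA ψB hψA hψB => ?_⟩
  obtain ⟨tr, htr⟩ := exists_isRelativeTrace hA hB (hA.nakayama_map hcent hψA)
  have hF : IsTwistedFrobeniusWith j ψA ψB (lamA - lamB) (pA + pB) tr :=
    htr.isTwistedFrobeniusWith hj hA hB hproj hψA hψB (hB.nakayama_map hi_cent hψB)
  refine ⟨⟨tr, hF⟩, fun n dx x y hxy =>
    ⟨tr, fun k a ha => htr.eq_sum_of_isDualGenerators hA hB hψA hxy ha, hF⟩, ?_⟩
  obtain ⟨n, d, x, y, hxy⟩ := hF.exists_isTwistedDualGenerators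
  rw [← neg_sub lamA lamB]
  exact ⟨hxy.adjunction hF⟩
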